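/- **Setting.** Let $d\ge 1$, let $\mathrm{U}(d)$ be the group of $d\times d$ unitary matrices and $\|\cdot\|$ the operator norm. For $U,V\in \mathrm{U}(d)$ let $\mathrm{dist}(U,V)=\inf_\gamma\int_0^1\|\gamma'(t)\|\,dt$ over smooth paths $\gamma:[0,1]\to \mathrm{U}(d)$ from $U$ to $V$, and let $\mathrm{dist}(U,V\,\mathrm{U}(1))=\inf_{|\phi|=1}\mathrm{dist}(U,\phi V)$. For a skew-Hermitian $X$ with $\|X\|<\pi$ and $r>0$ put $(e^X)^r=e^{rX}$. For $U\in\mathrm{U}(d)$ known only up to a phase, $U^{1/p}$ means $(\phi U)^{1/p}$ for a phase $\phi$ such that $\phi U=e^X$ with $\|X\|<\pi$, and such that $\mathrm{dist}(\mathbb I,\phi U)<\frac1{3\pi}$ whenever $\mathrm{dist}(\mathbb I,U\,\mathrm U(1))<\frac1{3\pi}$ (any Borel rule that chooses $\phi$ is allowed). A *tomography algorithm* draws a random seed (of arbitrary distribution) and then, depending on it, runs an adaptive procedure on a qudit of dimension $d$ and a finite-dimensional ancilla, starting in the state $|0\rangle$: it applies an oracle $Z\in\mathrm{U}(d)$ to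 the qudit (a query), or performs a quantum instrument with finitely many outcomes, each step depending on the outcomes so far, and finally it outputs a unitary $\boldsymbol U\in\mathrm{U}(d)$. It uses $Q$ queries if it never makes more than $Q$ queries, for any seed and any outcomes. **Bootstrap algorithm.** Let $\mathcal A$ be a tomography algorithm, $\varepsilon_0\le\frac1{600}$, $\varepsilon,\eta\in(0,1)$, $c>0$. Put $T=\lceil\log_2(1/\varepsilon)\rceil$ and $V_0=\mathbb I$. For $j=0,\dots,T$ let $p_j=2^j$, $\eta_j=\eta\, 8^{\,j-T-1}$, $N_j=\lceil c\log(1/\eta_j)\rceil$; run $\mathcal A$ independently $N_j$ times with the oracle $(ZV_j^\dagger)^{p_j}$ (each of whose applications costs $p_j$ queries to $Z$); let $U_j$ be the first of the $N_j$ outputs $W$ that are *central*, i.e. such that at least $0.505N_j$ of the outputs $W'$ satisfy $\mathrm{dist}(W,W'\,\mathrm{U}(1))\le 2\varepsilon_0$ (and $U_j=\mathbb I$ if there is none); and put $V_{j+1}=U_j^{1/p_j}V_j$. Output $\boldsymbol U=V_{T+1}$. **Theorem.** There are universal constants $c,C>0$ with the following property. Let $d\ge1$, $\varepsilon_0\le\frac{1}{600}$,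 and let $\mathcal A$ be a tomography algorithm which, for every oracle $Z\in\mathrm{U}(d)$, outputs $\boldsymbol U$ with $\mathrm{dist}(Z,\boldsymbol U\,\mathrm{U}(1))\le\varepsilon_0$ with probability $>0.51$. Then for all $\varepsilon,\eta\in(0,1)$ and every oracle $Z\in\mathrm{U}(d)$ the output $\boldsymbol U$ of the bootstrap algorithm satisfies (a) $\mathrm{dist}(Z,\boldsymbol U\,\mathrm{U}(1))\le\varepsilon$ with probability $\ge 1-\eta$; (b) $\mathbb E[\mathrm{dist}(Z,\boldsymbol U\,\mathrm{U}(1))^2]\le(1+32\eta)\varepsilon^2$. If moreover $\mathcal A$ uses $Q$ queries, then the bootstrap algorithm uses at most $C\,\frac{Q}{\varepsilon}\max\{1,\log\frac1\eta\}$ queries to $Z$. -/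

import Mathlib

open MeasureTheory
open scoped Matrix Kronecker Matrix.Norms.L2Operator ContDiff

noncomputable section

namespace Tomography

/-! ### The unitary group and its intrinsic metrics

Matrices carry the operator norm (largest singular value), through the scope
`Matrix.Norms.L2Operator`. -/

/-- The group of `d × d` unitary matrices. -/
abbrev UU (d : ℕ) : Type := Matrix.unitaryGroup (Fin d) ℂ

instance (d : ℕ) : MeasurableSpace (UU d) := borel _

instance (d : ℕ) : BorelSpace (UU d) := ⟨rfl⟩

/-- `γ` restricts to a smooth path `[0,1] → U(d)` from `U` to `V`. -/
structure IsSmoothPath {d : ℕ} (U V : Matrix (Fin d) (Fin d) ℂ)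
    (γ : ℝ → Matrix (Fin d) (Fin d) ℂ) : Prop where
  smooth : ContDiffOn ℝ ∞ γ (Set.Icc 0 1)
  unitary : ∀ t ∈ Set.Icc (0 : ℝ) 1, γ t ∈ Matrix.unitaryGroup (Fin d) ℂ
  source : γ 0 = U
  target : γ 1 = V

/-- The length of a path on `[0,1]`, measured in operator norm. -/
def pathLength {d : ℕ} (γ : ℝ → Matrix (Fin d) (Fin d) ℂ) : ℝ :=
  ∫ t in (0 : ℝ)..1, ‖derivWithin γ (Set.Icc 0 1) t‖

/-- The intrinsic distance `dist(U, V)` of unitary matrices. -/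
def idist {d : ℕ} (U V : Matrix (Fin d) (Fin d) ℂ) : ℝ :=
  sInf {l : ℝ | ∃ γ, IsSmoothPath U V γ ∧ l = pathLength γ}

/-- The projective intrinsic distance `dist(U, V U(1)) = inf_φ dist(U, φ V)`. -/
def pdist {d : ℕ} (U V : Matrix (Fin d) (Fin d) ℂ) : ℝ :=
  ⨅ φ : Circle, idist U ((φ : ℂ) • V)

/-! ### Roots -/

/-- `W = U ^ r`, the fractional power: `(e ^ X) ^ r = e ^ (r X)` for skew-Hermitian `X` with
`‖X‖ < π`. -/
def IsFracPow {d : ℕ} (r : ℝ) (U W : Matrix (Fin d) (Fin d) ℂ) : Prop :=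
  ∃ X : Matrix (Fin d) (Fin d) ℂ, Xᴴ = -X ∧ ‖X‖ < Real.pi ∧
    NormedSpace.exp X = U ∧ W = NormedSpace.exp (r • X)

/-- `W` is the `p`-th root of a representative `φ U` of the class `U(1) U`. The representative
lies in the ball of radius `1 / (3 π)` around the identity whenever the class meets this ball;
otherwise it is any representative for which the root is defined. -/
def IsProjRoot {d : ℕ} (p : ℕ) (U W : Matrix (Fin d) (Fin d) ℂ) : Prop :=
  ∃ φ : Circle,
    (pdist 1 U < 1 / (3 * Real.pi) → idist 1 ((φ : ℂ) • U) < 1 / (3 * Real.pi)) ∧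
    IsFracPow (1 / (p : ℝ)) ((φ : ℂ) • U) W

/-- A (Borel) rule for taking roots of unitaries that are known up to a phase. -/
structure IsRootRule {d : ℕ} (root : ℕ → UU d → UU d) : Prop where
  isProjRoot : ∀ p : ℕ, 1 ≤ p → ∀ U : UU d, IsProjRoot p (U : Matrix (Fin d) (Fin d) ℂ) (root p U)
  measurable : ∀ p : ℕ, Measurable (root p)

/-! ### Quantum query algorithms -/

/-- Index set of the computational basis of the register: the qudit on which the oracle acts,
and an ancilla of dimension `k + 1`. -/
abbrev Reg (d k : ℕ) : Type := Fin d × Fin (k + 1)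

/-- Operators on the register. -/
abbrev Op (d k : ℕ) : Type := Matrix (Reg d k) (Reg d k) ℂ

/-- An adaptive quantum query algorithm: it halts with a classical description of a unitary,
or it applies the oracle to the qudit, or it performs a quantum instrument, given by its Kraus
operators, and continues depending on the observed outcome. Known unitaries, preparations,
measurements and classical coins are all instruments. -/
inductive Prog (d k : ℕ) : Type
  | output (U : UU d) : Prog d k
  | query (next : Prog d k) : Prog d k
  | instrument {m : ℕ} (K : Fin m → Op d k) (hK : ∑ i, (K i)ᴴ * K i = 1)
      (next : Fin m → Prog d k) : Prog d k

/-- The operator `U ⊗ 1` on the register. -/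
def onQudit {d : ℕ} (k : ℕ) (U : UU d) : Op d k :=
  (U : Matrix (Fin d) (Fin d) ℂ) ⊗ₖ (1 : Matrix (Fin (k + 1)) (Fin (k + 1)) ℂ)

theorem onQudit_isometry {d : ℕ} (k : ℕ) (U : UU d) :
    (onQudit k U)ᴴ * onQudit k U = 1 := by
  have h : (U : Matrix (Fin d) (Fin d) ℂ)ᴴ * (U : Matrix (Fin d) (Fin d) ℂ) = 1 :=
    Matrix.UnitaryGroup.star_mul_self U
  rw [onQudit, Matrix.conjTranspose_kronecker, ← Matrix.mul_kronecker_mul, h,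
    Matrix.conjTranspose_one, Matrix.one_mul, Matrix.one_kronecker_one]

namespace Prog

variable {d k : ℕ}

/-- The largest number of oracle queries along a branch. -/
def queries : Prog d k → ℕ
  | output _ => 0
  | query next => next.queries + 1
  | instrument _ _ next => Finset.univ.sup fun i => (next i).queries

/-- The distribution of the output if the oracle is `Z` and the register is in the
(subnormalized) state `ρ`. -/
def run (Z : UU d) : Prog d k → Op d k → Measure (UU d)
  | output U, ρ => ENNReal.ofReal ρ.trace.re • Measure.dirac U
  | query next, ρ => next.run Z (onQudit k Z * ρ * (onQudit k Z)ᴴ)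
  | instrument K _ next, ρ => ∑ i, (next i).run Z (K i * ρ * (K i)ᴴ)

/-- The initial state `|0⟩⟨0|` of the register. -/
def initial (d k : ℕ) [NeZero d] : Op d k := Matrix.single (0, 0) (0, 0) 1

/-- The output distribution with oracle `Z`, started in the initial state. -/
def out [NeZero d] (P : Prog d k) (Z : UU d) : Measure (UU d) := P.run Z (initial d k)

/-- Apply the known unitary `U` to the qudit. -/
def gate (U : UU d) (next : Prog d k) : Prog d k :=
  instrument (m := 1) (fun _ => onQudit k U) (by simpa using onQudit_isometry k U) fun _ => next

/-- Kraus operators `|0⟩⟨i|` of the reset of the register. -/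
def resetKraus (d k : ℕ) [NeZero d] (i : Fin (d * (k + 1))) : Op d k :=
  Matrix.single (0, 0) (finProdFinEquiv.symm i) 1

theorem resetKraus_sum (d k : ℕ) [NeZero d] :
    ∑ i, (resetKraus d k i)ᴴ * resetKraus d k i = 1 := by
  have h : ∀ i, (resetKraus d k i)ᴴ * resetKraus d k i =
      (fun x : Reg d k => Matrix.single x x (1 : ℂ)) (finProdFinEquiv.symm i) := by
    intro i
    simp [resetKraus, Matrix.conjTranspose_single]
  rw [Finset.sum_congr rfl fun i _ => h i,
    Equiv.sum_comp finProdFinEquiv.symm fun x : Reg d k => Matrix.single x x (1 : ℂ)]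
  ext a b
  simp [Matrix.sum_apply, Matrix.single_apply, Matrix.one_apply, Finset.filter_and,
    Finset.filter_eq']
  by_cases hab : a = b <;> simp [hab]

/-- Put the register back into its initial state. -/
def reset [NeZero d] (next : Prog d k) : Prog d k :=
  instrument (resetKraus d k) (resetKraus_sum d k) fun _ => next

/-- Run a program, reset the register and go on with a program that depends on the output. -/
def bind [NeZero d] (g : UU d → Prog d k) : Prog d k → Prog d k
  | output U => reset (g U)
  | query next => query (next.bind g)
  | instrument K hK next => instrument K hK fun i => (next i).bind g

/-- Apply `(Z V†) ^ p` to the qudit, by `p` queries to `Z`. -/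
def queryPow (V : UU d) : ℕ → Prog d k → Prog d k
  | 0, next => next
  | p + 1, next => gate V⁻¹ (query (queryPow V p next))

/-- Replace the oracle `Z` of a program by `(Z V†) ^ p`. -/
def withOracle (V : UU d) (p : ℕ) : Prog d k → Prog d k
  | output U => output U
  | query next => queryPow V p (next.withOracle V p)
  | instrument K hK next => instrument K hK fun i => (next i).withOracle V p

/-- Run `n` programs one after the other and go on depending on all the outputs. -/
def runAll [NeZero d] : {n : ℕ} → (Fin n → Prog d k) → ((Fin n → UU d) → Prog d k) → Prog d k
  | 0, _, g => g Fin.elim0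
  | _ + 1, P, g => (P 0).bind fun U => runAll (Fin.tail P) fun u => g (Fin.cons U u)

end Prog

/-- A tomography algorithm: a random seed of arbitrary distribution is drawn, and then a
query algorithm that depends on the seed is executed. -/
structure Estimator (d : ℕ) where
  Seed : Type
  [measSeed : MeasurableSpace Seed]
  μ : Measure Seed
  [prob : IsProbabilityMeasure μ]
  ancilla : ℕ
  prog : Seed → Prog d ancilla

attribute [instance] Estimator.measSeed Estimator.prob

namespace Estimator

variable {d : ℕ}

/-- The output distribution depends measurably on the seed, so that the output is a random
variable. -/
def IsMeasurable [NeZero d] (A : Estimator d) : Prop :=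
  ∀ Z : UU d, Measurable fun s => (A.prog s).out Z

/-- The law of the output when the oracle is `Z`. -/
def law [NeZero d] (A : Estimator d) (Z : UU d) : Measure (UU d) :=
  A.μ.bind fun s => (A.prog s).out Z

/-- `A` never uses more than `q` queries. -/
def UsesAtMost (A : Estimator d) (q : ℝ) : Prop :=
  ∀ s, ((A.prog s).queries : ℝ) ≤ q

end Estimator

/-! ### The bootstrap algorithm -/

/-- The estimate `u i` is central: at least `0.505 n` of the `n` estimates are within `r`. -/
def IsCentral {d n : ℕ} (r : ℝ) (u : Fin n → UU d) (i : Fin n) : Prop :=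
  0.505 * (n : ℝ) ≤ ({j : Fin n | pdist (u i : Matrix (Fin d) (Fin d) ℂ) (u j) ≤ r}.ncard : ℝ)

open Classical in
/-- The first central estimate (the identity if there is none). -/
def central {d n : ℕ} (r : ℝ) (u : Fin n → UU d) : UU d :=
  if h : (Finset.univ.filter (IsCentral r u)).Nonempty then
    u ((Finset.univ.filter (IsCentral r u)).min' h)
  else 1

/-- The main loop with the current estimate `V`. A round with exponent `p 0` and `N 0`
repetitions estimates `(Z V†) ^ (p 0)` by the central one, `U`, among `N 0` independent runs of
the base algorithm, and replaces `V` by `U ^ (1 / p 0) V`. -/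
def bootLoop {d : ℕ} [NeZero d] (A : Estimator d) (root : ℕ → UU d → UU d) (r : ℝ) :
    {n : ℕ} → (p N : Fin n → ℕ) → ((j : Fin n) → Fin (N j) → A.Seed) → UU d → Prog d A.ancilla
  | 0, _, _, _, V => Prog.output V
  | _ + 1, p, N, s, V =>
      Prog.runAll (fun i => (A.prog (s 0 i)).withOracle V (p 0)) fun u =>
        bootLoop A root r (fun j => p j.succ) (fun j => N j.succ) (fun j => s j.succ)
          (root (p 0) (central r u) * V)

/-- `T = ⌈log₂ (1 / ε)⌉`. -/
def rounds (ε : ℝ) : ℕ := ⌈Real.logb 2 (1 / ε)⌉₊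

/-- `η_j = η 8 ^ (j - T - 1)`. -/
def failure (ε η : ℝ) (j : ℕ) : ℝ := η * (8 : ℝ) ^ ((j : ℤ) - rounds ε - 1)

/-- The number `⌈c log (1 / η_j)⌉` of runs of the base algorithm in round `j`. -/
def repetitions (c ε η : ℝ) (j : ℕ) : ℕ := ⌈c * Real.log (1 / failure ε η j)⌉₊

/-- The bootstrap algorithm built on the base algorithm `A` of accuracy `ε₀`: rounds
`j = 0, …, T` with exponents `2 ^ j`, starting from the estimate `1`. All runs of `A` use
independent seeds. -/
def bootstrap {d : ℕ} [NeZero d] (c : ℝ) (A : Estimator d) (root : ℕ → UU d → UU d)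
    (ε₀ ε η : ℝ) : Estimator d where
  Seed := (j : Fin (rounds ε + 1)) → Fin (repetitions c ε η j) → A.Seed
  μ := Measure.pi fun _ => Measure.pi fun _ => A.μ
  ancilla := A.ancilla
  prog s := bootLoop A root (2 * ε₀) (fun j => 2 ^ (j : ℕ)) (fun j => repetitions c ε η j) s 1

end Tomography

end

/-!
If `V` is within `0.04 / p` of `Z` up to a phase, then `(Z V†) ^ p` is, up to a phase, the
exponential of a small skew-Hermitian matrix. There the exponential is almost an isometry, so an
estimate of `(Z V†) ^ p` of accuracy `1 / 200` has a `p`-th root that estimates `Z V†` with an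
error of less than `0.02 / p`: the accuracy has doubled, and the next round can double `p`. In the
first round nothing needs to be known, as no root is taken.

A round succeeds as soon as at least `0.505 N` of its `N` runs of the base algorithm are accurate to
`ε₀`: any central estimate then shares a neighbour with the true value and is within `3 ε₀` of it.
By Hoeffding's inequality this fails with probability at most `exp (-N / 20000)`, uniformly in the
past, so that after conditioning on the past the rounds behave like a Markov chain.

Even after a failure the loss stays under control: the rounds `j, j + 1, …` move the estimate by
at most `π / 2 ^ j + π / 2 ^ (j + 1) + … ≤ 2 π / 2 ^ j`, whatever they do. So a loss function that
is at most `b` if all rounds succeed and at most `B j` at distance `3 π / 2 ^ j` from `Z` has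
expectation at most `b + ∑ j, B j * η_j`. Both error bounds are instances of this.
-/

namespace Tomography

open NormedSpace

/-! ### Exponentials of skew-adjoint elements of a C⋆-algebra -/

section SkewAdjoint

variable {A : Type*} [CStarAlgebra A] {X Y U : A}

theorem exp_mem_unitary (hX : X ∈ skewAdjoint A) : exp X ∈ unitary A := by
  let +nondep : NormedAlgebra ℚ A := .restrictScalars ℚ ℂ A
  exact exp_mem_unitary_of_mem_skewAdjoint hX

theorem norm_exp_sub_one_eq (hX : X ∈ skewAdjoint A) (hle : ‖X‖ ≤ Real.pi) :
    ‖exp X - 1‖ = 2 * Real.sin (‖X‖ / 2) := by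
  let x : selfAdjoint A := skewAdjoint.negISMul ⟨X, hX⟩
  have hIx : Complex.I • (x : A) = X := skewAdjoint.I_smul_neg_I ⟨X, hX⟩
  have hx : ‖x‖ = ‖X‖ := by rw [← hIx, norm_smul, Complex.norm_I, one_mul]; rfl
  have hsq := selfAdjoint.norm_sq_expUnitary_sub_one (x := x) (hx.trans_le hle)
  rw [selfAdjoint.expUnitary_coe, hIx, hx] at hsq
  have hsin : 0 ≤ Real.sin (‖X‖ / 2) :=
    Real.sin_nonneg_of_nonneg_of_le_pi (by positivity) (by linarith [norm_nonneg X])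
  refine (pow_left_inj₀ (norm_nonneg _) (by positivity) two_ne_zero).1 ?_
  rw [hsq, mul_pow, Real.sin_sq_eq_half_sub]
  ring_nf

theorem norm_le_half_pi_mul_norm_exp_sub_one (hX : X ∈ skewAdjoint A) (hle : ‖X‖ ≤ Real.pi) :
    ‖X‖ ≤ Real.pi / 2 * ‖exp X - 1‖ := by
  have hsin : 2 / Real.pi * (‖X‖ / 2) ≤ Real.sin (‖X‖ / 2) :=
    Real.mul_le_sin (by positivity) (by linarith)
  calc ‖X‖ = Real.pi * (2 / Real.pi * (‖X‖ / 2)) := by field_simp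
    _ ≤ Real.pi * Real.sin (‖X‖ / 2) := by gcongr
    _ = Real.pi / 2 * ‖exp X - 1‖ := by rw [norm_exp_sub_one_eq hX hle]; ring

theorem exists_exp_eq_of_norm_sub_one_lt (hU : U ∈ unitary A) (h : ‖U - 1‖ < 2) :
    ∃ X ∈ skewAdjoint A, ‖X‖ ≤ Real.pi / 2 * ‖U - 1‖ ∧ exp X = U := by
  let u : unitary A := ⟨U, hU⟩
  let x := Unitary.argSelfAdjoint u
  have hskew : Complex.I • (x : A) ∈ skewAdjoint A := by
    rw [skewAdjoint.mem_iff, star_smul, selfAdjoint.mem_iff.1 x.2]; simp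
  have hexp : exp (Complex.I • (x : A)) = U := by
    rw [← selfAdjoint.expUnitary_coe]
    exact congrArg Subtype.val (expUnitary_argSelfAdjoint (u := u) h)
  have hnorm : ‖Complex.I • (x : A)‖ ≤ Real.pi := by
    rw [norm_smul, Complex.norm_I, one_mul]; exact Unitary.norm_argSelfAdjoint_le_pi u
  refine ⟨_, hskew, ?_, hexp⟩
  rw [← hexp]
  exact norm_le_half_pi_mul_norm_exp_sub_one hskew hnorm

theorem hasDerivAt_exp_smul_mul_exp_smul_neg (X Y : A) (t : ℝ) :
    HasDerivAt (fun s : ℝ => exp (s • X) * exp (s • -Y))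
      (exp (t • X) * (X - Y) * exp (t • -Y)) t :=
  ((hasDerivAt_exp_smul_const X t).mul (hasDerivAt_exp_smul_const' (-Y) t)).congr_deriv
    (by noncomm_ring)

theorem norm_exp_smul_mul_mul_exp_smul (hX : X ∈ skewAdjoint A) (hY : Y ∈ skewAdjoint A)
    (t : ℝ) (B : A) : ‖exp (t • X) * B * exp (t • Y)‖ = ‖B‖ := by
  rw [CStarRing.norm_mul_mem_unitary _ (exp_mem_unitary (skewAdjoint.smul_mem t hY)),
    CStarRing.norm_mem_unitary_mul _ (exp_mem_unitary (skewAdjoint.smul_mem t hX))]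

theorem norm_exp_mul_exp_neg_sub_one (hY : Y ∈ skewAdjoint A) :
    ‖exp X * exp (-Y) - 1‖ = ‖exp X - exp Y‖ := by
  let +nondep : NormedAlgebra ℚ A := .restrictScalars ℚ ℂ A
  have h : exp (-Y) * exp Y = 1 := by
    rw [← exp_add_of_commute (Commute.refl Y).neg_left, neg_add_cancel, exp_zero]
  rw [← CStarRing.norm_mul_mem_unitary _ (exp_mem_unitary hY), sub_mul, mul_assoc, h, mul_one,
    one_mul]

theorem norm_exp_sub_exp_le (hX : X ∈ skewAdjoint A) (hY : Y ∈ skewAdjoint A) :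
    ‖exp X - exp Y‖ ≤ ‖X - Y‖ := by
  rw [← norm_exp_mul_exp_neg_sub_one hY]
  simpa only [zero_smul, one_smul, exp_zero, mul_one] using
    norm_image_sub_le_of_norm_deriv_le_segment_01' (f := fun s : ℝ => exp (s • X) * exp (s • -Y))
      (fun t _ => (hasDerivAt_exp_smul_mul_exp_smul_neg X Y t).hasDerivWithinAt)
      fun t _ => (norm_exp_smul_mul_mul_exp_smul hX (neg_mem hY) t (X - Y)).le

theorem norm_exp_sub_one_le (hX : X ∈ skewAdjoint A) : ‖exp X - 1‖ ≤ ‖X‖ := by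
  simpa using norm_exp_sub_exp_le hX (zero_mem _)

theorem norm_exp_smul_sub_one_le (hX : X ∈ skewAdjoint A) {t : ℝ} (ht : t ∈ Set.Icc (0 : ℝ) 1) :
    ‖exp (t • X) - 1‖ ≤ ‖X‖ := by
  have h := norm_exp_sub_one_le (skewAdjoint.smul_mem t hX)
  rw [norm_smul, Real.norm_of_nonneg ht.1] at h
  exact h.trans (mul_le_of_le_one_left (norm_nonneg _) ht.2)

theorem norm_exp_mul_exp_neg_sub_one_sub_le (hX : X ∈ skewAdjoint A) (hY : Y ∈ skewAdjoint A) :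
    ‖exp X * exp (-Y) - 1 - (X - Y)‖ ≤ ‖X - Y‖ * (‖X‖ + ‖Y‖) := by
  have hbound : ∀ t ∈ Set.Ico (0 : ℝ) 1,
      ‖exp (t • X) * (X - Y) * exp (t • -Y) - (1 : ℝ) • (X - Y)‖ ≤ ‖X - Y‖ * (‖X‖ + ‖Y‖) := by
    intro t ht
    have htX := norm_exp_smul_sub_one_le hX (Set.Ico_subset_Icc_self ht)
    have htY := norm_exp_smul_sub_one_le (neg_mem hY) (Set.Ico_subset_Icc_self ht)
    calc ‖exp (t • X) * (X - Y) * exp (t • -Y) - (1 : ℝ) • (X - Y)‖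
        = ‖(exp (t • X) - 1) * (X - Y) * exp (t • -Y) + (X - Y) * (exp (t • -Y) - 1)‖ := by
          rw [one_smul]; noncomm_ring
      _ ≤ ‖(exp (t • X) - 1) * (X - Y)‖ + ‖(X - Y) * (exp (t • -Y) - 1)‖ := by
          refine (norm_add_le _ _).trans_eq ?_
          rw [CStarRing.norm_mul_mem_unitary _
            (exp_mem_unitary (skewAdjoint.smul_mem t (neg_mem hY)))]
      _ ≤ ‖X‖ * ‖X - Y‖ + ‖X - Y‖ * ‖-Y‖ := by
          gcongr <;> refine (norm_mul_le _ _).trans (by gcongr)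
      _ = ‖X - Y‖ * (‖X‖ + ‖Y‖) := by rw [norm_neg]; ring
  simpa [sub_right_comm] using norm_image_sub_le_of_norm_deriv_le_segment_01'
    (f := fun s : ℝ => exp (s • X) * exp (s • -Y) - s • (X - Y))
    (fun t _ => ((hasDerivAt_exp_smul_mul_exp_smul_neg X Y t).sub
      ((hasDerivAt_id t).smul_const (X - Y))).hasDerivWithinAt) hbound

theorem norm_sub_mul_le_norm_exp_sub_exp (hX : X ∈ skewAdjoint A) (hY : Y ∈ skewAdjoint A) :
    ‖X - Y‖ * (1 - ‖X‖ - ‖Y‖) ≤ ‖exp X - exp Y‖ := by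
  have htri := norm_sub_le (exp X * exp (-Y) - 1) (exp X * exp (-Y) - 1 - (X - Y))
  rw [sub_sub_cancel, norm_exp_mul_exp_neg_sub_one hY] at htri
  linarith [norm_exp_mul_exp_neg_sub_one_sub_le hX hY]

theorem I_smul_one_mem_skewAdjoint (a : ℝ) : ((a : ℂ) * Complex.I) • (1 : A) ∈ skewAdjoint A := by
  rw [skewAdjoint.mem_iff, star_smul, star_one, ← neg_smul]
  simp

theorem circle_exp_smul_exp (a : ℝ) (X : A) :
    (Circle.exp a : ℂ) • exp X = exp (((a : ℂ) * Complex.I) • (1 : A) + X) := by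
  let +nondep : NormedAlgebra ℚ A := .restrictScalars ℚ ℂ A
  have h : exp (((a : ℂ) * Complex.I) • (1 : A)) = (Circle.exp a : ℂ) • (1 : A) := by
    rw [← Algebra.algebraMap_eq_smul_one, ← algebraMap_exp_comm, Algebra.algebraMap_eq_smul_one,
      Circle.coe_exp, Complex.exp_eq_exp_ℂ]
  rw [exp_add_of_commute ((Commute.one_left X).smul_left _), h, smul_one_mul]

theorem exists_circle_exp_eq_norm_le (χ : Circle) : ∃ a : ℝ, Circle.exp a = χ ∧
    ‖((a : ℂ) * Complex.I) • (1 : A)‖ ≤ Real.pi / 2 * ‖(χ : ℂ) • (1 : A) - 1‖ := by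
  let a := Complex.arg (χ : ℂ)
  have hexp : exp (((a : ℂ) * Complex.I) • (1 : A)) = (χ : ℂ) • (1 : A) := by
    simpa [a, Circle.exp_arg] using (circle_exp_smul_exp a (0 : A)).symm
  have hone : ‖(1 : A)‖ ≤ 1 := by
    cases subsingleton_or_nontrivial A
    · rw [Subsingleton.elim (1 : A) 0, norm_zero]; exact zero_le_one
    · exact CStarRing.norm_one.le
  refine ⟨a, Circle.exp_arg χ, ?_⟩
  rw [← hexp]
  refine norm_le_half_pi_mul_norm_exp_sub_one (I_smul_one_mem_skewAdjoint a) ?_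
  rw [norm_smul]
  exact (mul_le_of_le_one_right (norm_nonneg _) hone).trans
    (by simpa using Complex.abs_arg_le_pi (χ : ℂ))

theorem circle_smul_mem_unitary {U : A} (φ : Circle) (hU : U ∈ unitary A) :
    (φ : ℂ) • U ∈ unitary A :=
  Unitary.smul_mem_of_mem (by simp [Unitary.mem_iff, ← Circle.coe_inv_eq_conj]) hU

end SkewAdjoint

/-! ### The intrinsic metric -/

section IntrinsicMetric

variable {d : ℕ}

local notation "𝐌" => Matrix (Fin d) (Fin d) ℂ

variable {U V W X Y : Matrix (Fin d) (Fin d) ℂ} {γ : ℝ → Matrix (Fin d) (Fin d) ℂ}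

theorem mul_star_mul_cancel (hU : U ∈ unitary 𝐌) (V : 𝐌) : U * (star U * V) = V := by
  rw [← mul_assoc, Unitary.mul_star_self_of_mem hU, one_mul]

theorem mul_star_mul_cancel_right (hV : V ∈ unitary 𝐌) (U : 𝐌) : U * star V * V = U := by
  rw [mul_assoc, Unitary.star_mul_self_of_mem hV, mul_one]

theorem norm_mul_star_sub_one (hV : V ∈ unitary 𝐌) : ‖U * star V - 1‖ = ‖U - V‖ := by
  rw [← CStarRing.norm_mul_mem_unitary _ hV, sub_mul, mul_star_mul_cancel_right hV, one_mul]

theorem circle_inv_smul_smul (φ : Circle) (U : 𝐌) : ((φ⁻¹ : Circle) : ℂ) • (φ : ℂ) • U = U := by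
  rw [smul_smul, ← Circle.coe_mul, inv_mul_cancel, Circle.coe_one, one_smul]

theorem exists_circle_smul_norm_sub_one_lt (hU : U ∈ unitary 𝐌) :
    ∃ φ : Circle, ‖(φ : ℂ) • U - 1‖ < 2 := by
  have : Infinite Circle := Circle.argEquiv.infinite_iff.2
    (Set.infinite_coe_iff.2 (Set.Ioc_infinite (by linarith [Real.pi_pos])))
  have hfin : {φ : Circle | -((φ⁻¹ : Circle) : ℂ) ∈ spectrum ℂ U}.Finite :=
    (Matrix.finite_spectrum U).preimage fun φ _ ψ _ h => Circle.ext (by simpa using h)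
  obtain ⟨φ, hφ⟩ := hfin.infinite_compl.nonempty
  have hsmul : (Units.mk0 (φ : ℂ) φ.coe_ne_zero) • -((φ⁻¹ : Circle) : ℂ) = -1 := by
    rw [Units.smul_def, Units.val_mk0, smul_eq_mul, mul_neg, ← Circle.coe_mul, mul_inv_cancel,
      Circle.coe_one]
  refine ⟨φ, (Unitary.norm_sub_one_lt_two_iff (circle_smul_mem_unitary φ hU)).2 fun hmem => hφ ?_⟩
  rw [Set.mem_ofPred_eq, ← spectrum.smul_mem_smul_iff (r := Units.mk0 (φ : ℂ) φ.coe_ne_zero), hsmul]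
  exact hmem

namespace IsSmoothPath

theorem hasDerivWithinAt (h : IsSmoothPath U V γ) {t : ℝ} (ht : t ∈ Set.Icc (0 : ℝ) 1) :
    HasDerivWithinAt γ (derivWithin γ (Set.Icc 0 1) t) (Set.Icc 0 1) t :=
  (h.smooth.differentiableOn (by simp) t ht).hasDerivWithinAt

theorem intervalIntegrable (h : IsSmoothPath U V γ) :
    IntervalIntegrable (derivWithin γ (Set.Icc 0 1)) volume 0 1 := by
  refine ContinuousOn.intervalIntegrable ?_
  rw [Set.uIcc_of_le zero_le_one]
  exact h.smooth.continuousOn_derivWithin (uniqueDiffOn_Icc zero_lt_one) (by simp)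

theorem norm_sub_le_pathLength (h : IsSmoothPath U V γ) : ‖U - V‖ ≤ pathLength γ := by
  have hint : ∫ t in (0 : ℝ)..1, derivWithin γ (Set.Icc 0 1) t = V - U := by
    rw [← h.source, ← h.target]
    exact intervalIntegral.integral_eq_sub_of_hasDerivAt_of_le zero_le_one h.smooth.continuousOn
      (fun t ht => (h.hasDerivWithinAt (Set.Ioo_subset_Icc_self ht)).hasDerivAt
        (Icc_mem_nhds ht.1 ht.2)) h.intervalIntegrable
  rw [norm_sub_rev, ← hint]
  exact intervalIntegral.norm_integral_le_integral_norm zero_le_one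

end IsSmoothPath

theorem pathLength_nonneg (γ : ℝ → 𝐌) : 0 ≤ pathLength γ :=
  intervalIntegral.integral_nonneg zero_le_one fun _ _ => norm_nonneg _

theorem idist_nonneg (U V : 𝐌) : 0 ≤ idist U V :=
  Real.sInf_nonneg (by rintro _ ⟨γ, -, rfl⟩; exact pathLength_nonneg γ)

theorem idist_le_pathLength (h : IsSmoothPath U V γ) : idist U V ≤ pathLength γ :=
  csInf_le ⟨0, by rintro _ ⟨γ, -, rfl⟩; exact pathLength_nonneg γ⟩ ⟨γ, h, rfl⟩

theorem idist_le_integral (h : IsSmoothPath U V γ) {f : ℝ → ℝ}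
    (hf : IntervalIntegrable f volume 0 1)
    (hle : ∀ t ∈ Set.Icc (0 : ℝ) 1, ‖derivWithin γ (Set.Icc 0 1) t‖ ≤ f t) :
    idist U V ≤ ∫ t in (0 : ℝ)..1, f t :=
  (idist_le_pathLength h).trans
    (intervalIntegral.integral_mono_on zero_le_one h.intervalIntegrable.norm hf hle)

theorem isSmoothPath_exp_smul_mul_exp_smul_mul (hX : X ∈ skewAdjoint 𝐌) (hY : Y ∈ skewAdjoint 𝐌)
    (hU : U ∈ unitary 𝐌) :
    IsSmoothPath U (exp X * exp (-Y) * U) (fun t => exp (t • X) * exp (t • -Y) * U) where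
  smooth := by
    have h : ContDiff ℝ ∞ (exp : 𝐌 → 𝐌) :=
      AnalyticOnNhd.contDiff fun x _ => exp_analytic (𝕂 := ℝ) x
    exact (((h.comp (contDiff_id.smul contDiff_const)).mul
      (h.comp (contDiff_id.smul contDiff_const))).mul contDiff_const).contDiffOn
  unitary t _ := mul_mem (mul_mem (exp_mem_unitary (skewAdjoint.smul_mem t hX))
    (exp_mem_unitary (skewAdjoint.smul_mem t (neg_mem hY)))) hU
  source := by simp
  target := by simp

theorem idist_exp_mul_exp_neg_mul_le (hX : X ∈ skewAdjoint 𝐌) (hY : Y ∈ skewAdjoint 𝐌)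
    (hU : U ∈ unitary 𝐌) : idist U (exp X * exp (-Y) * U) ≤ ‖X - Y‖ := by
  refine (idist_le_integral (isSmoothPath_exp_smul_mul_exp_smul_mul hX hY hU)
    intervalIntegrable_const fun t ht => ?_).trans_eq (by simp : ∫ _ in (0 : ℝ)..1, ‖X - Y‖ = _)
  have hderiv := (hasDerivAt_exp_smul_mul_exp_smul_neg X Y t).mul_const U
  rw [hderiv.hasDerivWithinAt.derivWithin (uniqueDiffOn_Icc zero_lt_one t ht),
    CStarRing.norm_mul_mem_unitary _ hU, norm_exp_smul_mul_mul_exp_smul hX (neg_mem hY)]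

theorem idist_exp_mul_le (hX : X ∈ skewAdjoint 𝐌) (hU : U ∈ unitary 𝐌) :
    idist U (exp X * U) ≤ ‖X‖ := by
  simpa using idist_exp_mul_exp_neg_mul_le hX (zero_mem _) hU

theorem idist_exp_exp_le (hX : X ∈ skewAdjoint 𝐌) (hY : Y ∈ skewAdjoint 𝐌) :
    idist (exp Y) (exp X) ≤ ‖X - Y‖ := by
  let +nondep : NormedAlgebra ℚ 𝐌 := .restrictScalars ℚ ℂ 𝐌
  have h := idist_exp_mul_exp_neg_mul_le hX hY (exp_mem_unitary hY)
  rwa [mul_assoc, ← exp_add_of_commute (Commute.refl Y).neg_left, neg_add_cancel, exp_zero,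
    mul_one] at h

theorem exists_isSmoothPath (hU : U ∈ unitary 𝐌) (hV : V ∈ unitary 𝐌) :
    ∃ γ, IsSmoothPath U V γ := by
  have hW := mul_mem hV (Unitary.star_mem hU)
  obtain ⟨φ, hφ⟩ := exists_circle_smul_norm_sub_one_lt hW
  obtain ⟨X, hX, -, hexp⟩ := exists_exp_eq_of_norm_sub_one_lt (circle_smul_mem_unitary φ hW) hφ
  obtain ⟨a, ha⟩ := Circle.exp_surjective φ⁻¹
  have hV' : V = exp (((a : ℂ) * Complex.I) • (1 : 𝐌) + X) * exp (-0) * U := by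
    rw [← circle_exp_smul_exp, ha, hexp, circle_inv_smul_smul, neg_zero, exp_zero, mul_one,
      mul_star_mul_cancel_right hU]
  rw [hV']
  exact ⟨_, isSmoothPath_exp_smul_mul_exp_smul_mul
    (add_mem (I_smul_one_mem_skewAdjoint a) hX) (zero_mem _) hU⟩

theorem exists_isSmoothPath_pathLength_lt (hU : U ∈ unitary 𝐌) (hV : V ∈ unitary 𝐌) {a : ℝ}
    (h : idist U V < a) : ∃ γ, IsSmoothPath U V γ ∧ pathLength γ < a := by
  obtain ⟨γ₀, h₀⟩ := exists_isSmoothPath hU hV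
  have hne : {l : ℝ | ∃ γ, IsSmoothPath U V γ ∧ l = pathLength γ}.Nonempty := ⟨_, γ₀, h₀, rfl⟩
  obtain ⟨_, ⟨γ, hγ, rfl⟩, hlt⟩ := exists_lt_of_csInf_lt hne h
  exact ⟨γ, hγ, hlt⟩

theorem norm_sub_le_idist (hU : U ∈ unitary 𝐌) (hV : V ∈ unitary 𝐌) : ‖U - V‖ ≤ idist U V := by
  refine le_of_forall_gt fun a ha => ?_
  obtain ⟨γ, hγ, hlt⟩ := exists_isSmoothPath_pathLength_lt hU hV ha
  exact hγ.norm_sub_le_pathLength.trans_lt hlt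

theorem idist_le_of_norm_sub_lt (hU : U ∈ unitary 𝐌) (hV : V ∈ unitary 𝐌) (h : ‖U - V‖ < 2) :
    idist U V ≤ Real.pi / 2 * ‖U - V‖ := by
  rw [norm_sub_rev, ← norm_mul_star_sub_one hU] at h ⊢
  obtain ⟨X, hX, hnorm, hexp⟩ :=
    exists_exp_eq_of_norm_sub_one_lt (mul_mem hV (Unitary.star_mem hU)) h
  have hle := idist_exp_mul_le hX hU
  rw [hexp, mul_star_mul_cancel_right hU] at hle
  exact hle.trans hnorm

/- A concatenation of smooth paths need not be smooth; the pointwise product `γ₁ V† γ₂` is smooth,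
and it is no longer than the two paths together. -/
theorem idist_triangle (hU : U ∈ unitary 𝐌) (hV : V ∈ unitary 𝐌) (hW : W ∈ unitary 𝐌) :
    idist U W ≤ idist U V + idist V W := by
  refine le_of_forall_pos_lt_add fun ε hε => ?_
  obtain ⟨γ₁, h₁, hlt₁⟩ := exists_isSmoothPath_pathLength_lt hU hV
    (lt_add_of_pos_right _ (half_pos hε))
  obtain ⟨γ₂, h₂, hlt₂⟩ := exists_isSmoothPath_pathLength_lt hV hW
    (lt_add_of_pos_right _ (half_pos hε))
  have hpath : IsSmoothPath U W (fun t => γ₁ t * star V * γ₂ t) :=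
    { smooth := (h₁.smooth.mul contDiffOn_const).mul h₂.smooth
      unitary := fun t ht => mul_mem (mul_mem (h₁.unitary t ht) (Unitary.star_mem hV))
        (h₂.unitary t ht)
      source := by rw [h₁.source, h₂.source, mul_star_mul_cancel_right hV]
      target := by rw [h₁.target, h₂.target, mul_assoc, mul_star_mul_cancel hV] }
  have hle : idist U W ≤ ∫ t in (0 : ℝ)..1,
      (‖derivWithin γ₁ (Set.Icc 0 1) t‖ + ‖derivWithin γ₂ (Set.Icc 0 1) t‖) := by
    refine idist_le_integral hpath (h₁.intervalIntegrable.norm.add h₂.intervalIntegrable.norm)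
      fun t ht => ?_
    have hderiv : HasDerivWithinAt (fun t => γ₁ t * star V * γ₂ t) _ (Set.Icc 0 1) t :=
      ((h₁.hasDerivWithinAt ht).mul_const (star V)).mul (h₂.hasDerivWithinAt ht)
    rw [hderiv.derivWithin (uniqueDiffOn_Icc zero_lt_one t ht)]
    refine (norm_add_le _ _).trans_eq ?_
    rw [CStarRing.norm_mul_mem_unitary _ (h₂.unitary t ht),
      CStarRing.norm_mul_mem_unitary _ (Unitary.star_mem hV),
      CStarRing.norm_mem_unitary_mul _ (mul_mem (h₁.unitary t ht) (Unitary.star_mem hV))]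
  rw [intervalIntegral.integral_add h₁.intervalIntegrable.norm h₂.intervalIntegrable.norm] at hle
  calc idist U W ≤ pathLength γ₁ + pathLength γ₂ := hle
    _ < idist U V + idist V W + ε := by linarith

theorem idist_map_le (f : 𝐌 →L[ℝ] 𝐌) (hf : ∀ W ∈ unitary 𝐌, f W ∈ unitary 𝐌)
    (hnorm : ∀ X, ‖f X‖ ≤ ‖X‖) (hU : U ∈ unitary 𝐌) (hV : V ∈ unitary 𝐌) :
    idist (f U) (f V) ≤ idist U V := by
  refine le_of_forall_gt fun a ha => ?_
  obtain ⟨γ, hγ, hlt⟩ := exists_isSmoothPath_pathLength_lt hU hV ha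
  have hpath : IsSmoothPath (f U) (f V) (fun t => f (γ t)) :=
    { smooth := f.contDiff.comp_contDiffOn hγ.smooth
      unitary := fun t ht => hf _ (hγ.unitary t ht)
      source := congrArg f hγ.source
      target := congrArg f hγ.target }
  refine lt_of_le_of_lt (idist_le_integral hpath hγ.intervalIntegrable.norm fun t ht => ?_) hlt
  have hderiv : HasDerivWithinAt (fun t => f (γ t)) _ (Set.Icc 0 1) t :=
    f.hasFDerivAt.comp_hasDerivWithinAt t (hγ.hasDerivWithinAt ht)
  rw [hderiv.derivWithin (uniqueDiffOn_Icc zero_lt_one t ht)]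
  exact hnorm _

theorem idist_mul_mul_le {A B : 𝐌} (hA : A ∈ unitary 𝐌) (hB : B ∈ unitary 𝐌) (hU : U ∈ unitary 𝐌)
    (hV : V ∈ unitary 𝐌) : idist (A * U * B) (A * V * B) ≤ idist U V :=
  idist_map_le (.mulLeftRight ℝ 𝐌 A B) (fun _ hW => mul_mem (mul_mem hA hW) hB)
    (fun X => by
      rw [ContinuousLinearMap.mulLeftRight_apply, CStarRing.norm_mul_mem_unitary _ hB,
        CStarRing.norm_mem_unitary_mul _ hA]) hU hV

/- The isometry `X ↦ V X† U` exchanges `U` and `V`. -/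
theorem idist_comm_le (hU : U ∈ unitary 𝐌) (hV : V ∈ unitary 𝐌) : idist V U ≤ idist U V := by
  have h := idist_map_le
    ((ContinuousLinearMap.mulLeftRight ℝ 𝐌 U V).comp ((starL' ℝ : 𝐌 ≃L[ℝ] 𝐌) : 𝐌 →L[ℝ] 𝐌))
    (fun _ hW => mul_mem (mul_mem hU (Unitary.star_mem hW)) hV)
    (fun X => by
      rw [ContinuousLinearMap.comp_apply, ContinuousLinearMap.mulLeftRight_apply,
        CStarRing.norm_mul_mem_unitary _ hV, CStarRing.norm_mem_unitary_mul _ hU]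
      exact (norm_star X).le) hU hV
  change idist (U * star U * V) (U * star V * V) ≤ _ at h
  rwa [Unitary.mul_star_self_of_mem hU, one_mul, mul_star_mul_cancel_right hV] at h

theorem idist_comm (hU : U ∈ unitary 𝐌) (hV : V ∈ unitary 𝐌) : idist U V = idist V U :=
  le_antisymm (idist_comm_le hV hU) (idist_comm_le hU hV)

theorem idist_smul_smul_le (φ : Circle) (hU : U ∈ unitary 𝐌) (hV : V ∈ unitary 𝐌) :
    idist ((φ : ℂ) • U) ((φ : ℂ) • V) ≤ idist U V := by
  simpa using idist_mul_mul_le (circle_smul_mem_unitary φ (one_mem _)) (one_mem _) hU hV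

end IntrinsicMetric

/-! ### The projective metric -/

section ProjectiveMetric

variable {d : ℕ}

local notation "𝐌" => Matrix (Fin d) (Fin d) ℂ

variable {U V W X : Matrix (Fin d) (Fin d) ℂ}

theorem pdist_nonneg (U V : 𝐌) : 0 ≤ pdist U V := le_ciInf fun _ => idist_nonneg _ _

theorem pdist_le_idist_smul (U V : 𝐌) (φ : Circle) : pdist U V ≤ idist U ((φ : ℂ) • V) :=
  ciInf_le ⟨0, by rintro _ ⟨φ, rfl⟩; exact idist_nonneg _ _⟩ φ

theorem pdist_le_idist (U V : 𝐌) : pdist U V ≤ idist U V := by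
  simpa using pdist_le_idist_smul U V 1

theorem pdist_smul_right (U V : 𝐌) (φ : Circle) : pdist U ((φ : ℂ) • V) = pdist U V := by
  refine le_antisymm (le_ciInf fun ψ => ?_) (le_ciInf fun ψ => ?_)
  · refine (pdist_le_idist_smul _ _ (ψ * φ⁻¹)).trans_eq ?_
    rw [Circle.coe_mul, mul_smul, circle_inv_smul_smul]
  · rw [smul_smul, ← Circle.coe_mul]
    exact pdist_le_idist_smul _ _ _

theorem pdist_triangle (hU : U ∈ unitary 𝐌) (hV : V ∈ unitary 𝐌) (hW : W ∈ unitary 𝐌) :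
    pdist U W ≤ pdist U V + pdist V W := by
  refine le_of_forall_pos_lt_add fun ε hε => ?_
  obtain ⟨φ, hφ⟩ := exists_lt_of_ciInf_lt (lt_add_of_pos_right (pdist U V) (half_pos hε))
  obtain ⟨ψ, hψ⟩ := exists_lt_of_ciInf_lt (lt_add_of_pos_right (pdist V W) (half_pos hε))
  have hψW := circle_smul_mem_unitary ψ hW
  calc pdist U W ≤ idist U ((φ : ℂ) • (ψ : ℂ) • W) := by
        rw [smul_smul, ← Circle.coe_mul]
        exact pdist_le_idist_smul U W (φ * ψ)
    _ ≤ idist U ((φ : ℂ) • V) + idist ((φ : ℂ) • V) ((φ : ℂ) • (ψ : ℂ) • W) :=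
        idist_triangle hU (circle_smul_mem_unitary φ hV) (circle_smul_mem_unitary φ hψW)
    _ < pdist U V + pdist V W + ε := by linarith [idist_smul_smul_le φ hV hψW]

theorem pdist_comm_le (hU : U ∈ unitary 𝐌) (hV : V ∈ unitary 𝐌) : pdist V U ≤ pdist U V := by
  refine le_ciInf fun φ => (pdist_le_idist_smul _ _ φ⁻¹).trans ?_
  have hφ := circle_smul_mem_unitary φ hV
  simpa only [circle_inv_smul_smul, idist_comm hφ hU] using idist_smul_smul_le φ⁻¹ hφ hU

theorem pdist_comm (hU : U ∈ unitary 𝐌) (hV : V ∈ unitary 𝐌) : pdist U V = pdist V U :=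
  le_antisymm (pdist_comm_le hV hU) (pdist_comm_le hU hV)

theorem pdist_mul_right_le (hU : U ∈ unitary 𝐌) (hV : V ∈ unitary 𝐌) (hW : W ∈ unitary 𝐌) :
    pdist (U * W) (V * W) ≤ pdist U V := by
  refine le_ciInf fun φ => (pdist_le_idist_smul _ _ φ).trans ?_
  simpa using idist_mul_mul_le (one_mem _) hW hU (circle_smul_mem_unitary φ hV)

theorem pdist_le_pi (hU : U ∈ unitary 𝐌) (hV : V ∈ unitary 𝐌) : pdist U V ≤ Real.pi := by
  obtain ⟨φ, hφ⟩ := exists_circle_smul_norm_sub_one_lt (mul_mem hV (Unitary.star_mem hU))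
  rw [← smul_mul_assoc, norm_mul_star_sub_one hU, norm_sub_rev] at hφ
  calc pdist U V ≤ idist U ((φ : ℂ) • V) := pdist_le_idist_smul U V φ
    _ ≤ Real.pi / 2 * ‖U - (φ : ℂ) • V‖ :=
      idist_le_of_norm_sub_lt hU (circle_smul_mem_unitary φ hV) hφ
    _ ≤ Real.pi := by nlinarith [Real.pi_pos]

theorem pdist_exp_mul_le (hX : X ∈ skewAdjoint 𝐌) (hU : U ∈ unitary 𝐌) (hV : V ∈ unitary 𝐌) :
    pdist U (exp X * V) ≤ pdist U V + ‖X‖ :=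
  (pdist_triangle hU hV (mul_mem (exp_mem_unitary hX) hV)).trans
    (add_le_add_right ((pdist_le_idist _ _).trans (idist_exp_mul_le hX hV)) _)

theorem tendsto_pdist_self (U : UU d) :
    Filter.Tendsto (fun V : UU d => pdist (U : 𝐌) V) (nhds U) (nhds 0) := by
  have hnorm : Filter.Tendsto (fun V : UU d => ‖(U : 𝐌) - V‖) (nhds U) (nhds 0) := by
    have : Continuous fun V : UU d => ‖(U : 𝐌) - V‖ := by fun_prop
    simpa using this.tendsto U
  refine squeeze_zero' (.of_forall fun V => pdist_nonneg _ _) ?_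
    (by simpa using hnorm.const_mul (Real.pi / 2))
  filter_upwards [hnorm.eventually_lt_const zero_lt_two] with V hV
  exact (pdist_le_idist _ _).trans (idist_le_of_norm_sub_lt U.2 V.2 hV)

theorem continuous_pdist : Continuous fun x : UU d × UU d => pdist (x.1 : 𝐌) (x.2 : 𝐌) := by
  rw [continuous_iff_continuousAt]
  rintro ⟨U, V⟩
  have hlim : Filter.Tendsto (fun x : UU d × UU d => pdist (U : 𝐌) x.1 + pdist (V : 𝐌) x.2)
      (nhds (U, V)) (nhds 0) := by
    simpa using ((tendsto_pdist_self U).comp (continuous_fst.tendsto (U, V))).add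
      ((tendsto_pdist_self V).comp (continuous_snd.tendsto (U, V)))
  refine tendsto_iff_norm_sub_tendsto_zero.2
    (squeeze_zero (fun _ => norm_nonneg _) (fun x => ?_) hlim)
  have hU₁ := pdist_triangle U.2 x.1.2 V.2
  have hU₂ := pdist_triangle x.1.2 x.2.2 V.2
  have hV₁ := pdist_triangle x.1.2 U.2 x.2.2
  have hV₂ := pdist_triangle U.2 V.2 x.2.2
  rw [pdist_comm x.2.2 V.2] at hU₂
  rw [pdist_comm x.1.2 U.2] at hV₁
  rw [Real.norm_eq_abs, abs_le]
  constructor <;> linarith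

theorem measurable_pdist : Measurable fun x : UU d × UU d => pdist (x.1 : 𝐌) (x.2 : 𝐌) :=
  continuous_pdist.measurable

theorem measurable_pdist_right (U : UU d) : Measurable fun V : UU d => pdist (U : 𝐌) V := by
  have hpair : Measurable fun V : UU d => (U, V) := measurable_prodMk_left
  simpa only [Function.comp_def] using measurable_pdist.comp hpair

theorem measurableSet_pdist_le (U : UU d) (r : ℝ) :
    MeasurableSet {V : UU d | pdist (U : 𝐌) V ≤ r} :=
  measurableSet_le (measurable_pdist_right U) measurable_const

end ProjectiveMetric

/-! ### One round of the bootstrap -/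

section Round

variable {d : ℕ}

local notation "𝐌" => Matrix (Fin d) (Fin d) ℂ

variable {U V W X Y Z : Matrix (Fin d) (Fin d) ℂ} {p : ℕ}

/- The phase that aligns `e ^ X` with `e ^ Y` is itself close to `1`, because both exponentials
are; hence it has a small logarithm. -/
theorem exists_norm_phase_add_sub_mul_le {δ : ℝ} (hX : X ∈ skewAdjoint 𝐌)
    (hY : Y ∈ skewAdjoint 𝐌) (h : pdist (exp Y) (exp X) < δ) :
    ∃ a : ℝ, ‖((a : ℂ) * Complex.I) • (1 : 𝐌) + X - Y‖ *
      (1 - Real.pi / 2 * (‖X‖ + ‖Y‖ + δ) - (‖X‖ + ‖Y‖)) ≤ δ := by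
  obtain ⟨χ, hχ⟩ := exists_lt_of_ciInf_lt h
  obtain ⟨a, rfl, ha⟩ := exists_circle_exp_eq_norm_le (A := 𝐌) χ
  have hP := I_smul_one_mem_skewAdjoint (A := 𝐌) a
  set P : 𝐌 := ((a : ℂ) * Complex.I) • 1
  have halign : ‖exp Y - (Circle.exp a : ℂ) • exp X‖ ≤ δ :=
    (norm_sub_le_idist (exp_mem_unitary hY)
      (circle_smul_mem_unitary _ (exp_mem_unitary hX))).trans hχ.le
  have hphase : ‖(Circle.exp a : ℂ) • (1 : 𝐌) - 1‖ ≤ ‖X‖ + δ + ‖Y‖ :=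
    calc ‖(Circle.exp a : ℂ) • (1 : 𝐌) - 1‖
        = ‖-((Circle.exp a : ℂ) • (exp X - 1)) + -(exp Y - (Circle.exp a : ℂ) • exp X) +
            (exp Y - 1)‖ := by rw [smul_sub]; abel_nf
      _ ≤ ‖exp X - 1‖ + δ + ‖exp Y - 1‖ := by
          refine norm_add₃_le.trans ?_
          rw [norm_neg, norm_neg, norm_smul, Circle.norm_coe, one_mul]
          gcongr
      _ ≤ ‖X‖ + δ + ‖Y‖ := by gcongr <;> exact norm_exp_sub_one_le ‹_›
  have hPn : ‖P‖ ≤ Real.pi / 2 * (‖X‖ + δ + ‖Y‖) := ha.trans (by gcongr)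
  refine ⟨a, ?_⟩
  calc ‖P + X - Y‖ * (1 - Real.pi / 2 * (‖X‖ + ‖Y‖ + δ) - (‖X‖ + ‖Y‖))
      ≤ ‖P + X - Y‖ * (1 - ‖P + X‖ - ‖Y‖) := by
        refine mul_le_mul_of_nonneg_left ?_ (norm_nonneg _)
        linarith [norm_add_le P X]
    _ ≤ ‖exp (P + X) - exp Y‖ := norm_sub_mul_le_norm_exp_sub_exp (add_mem hP hX) hY
    _ ≤ δ := by rwa [← circle_exp_smul_exp, norm_sub_rev]

theorem pdist_exp_one_div_smul_le (hX : X ∈ skewAdjoint 𝐌) (hY : Y ∈ skewAdjoint 𝐌) (hp : 0 < p)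
    (a : ℝ) : pdist (exp ((1 / (p : ℝ)) • Y)) (exp X) ≤
      ‖((a : ℂ) * Complex.I) • (1 : 𝐌) + (p : ℝ) • X - Y‖ / p := by
  have hscale : (((a / p : ℝ) : ℂ) * Complex.I) • (1 : 𝐌) + X - (1 / (p : ℝ)) • Y =
      (1 / (p : ℝ)) • (((a : ℂ) * Complex.I) • (1 : 𝐌) + (p : ℝ) • X - Y) := by
    rw [smul_sub, smul_add, smul_smul (1 / (p : ℝ)) (p : ℝ) X, one_div_mul_cancel (by positivity),
      one_smul]
    congr 2
    rw [← Complex.coe_smul, smul_smul]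
    congr 1
    push_cast
    ring
  calc pdist (exp ((1 / (p : ℝ)) • Y)) (exp X)
      = pdist (exp ((1 / (p : ℝ)) • Y)) (exp ((((a / p : ℝ) : ℂ) * Complex.I) • (1 : 𝐌) + X)) := by
        rw [← circle_exp_smul_exp, pdist_smul_right]
    _ ≤ ‖(((a / p : ℝ) : ℂ) * Complex.I) • (1 : 𝐌) + X - (1 / (p : ℝ)) • Y‖ :=
        (pdist_le_idist _ _).trans (idist_exp_exp_le
          (add_mem (I_smul_one_mem_skewAdjoint _) hX) (skewAdjoint.smul_mem _ hY))
    _ = _ := by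
        rw [hscale, norm_smul, Real.norm_of_nonneg (by positivity), one_div, inv_mul_eq_div]

theorem exists_exp_eq_circle_smul_mul_star (hU : U ∈ unitary 𝐌) (hV : V ∈ unitary 𝐌) {a : ℝ}
    (h : pdist U V < a) (ha : a ≤ 2) : ∃ φ : Circle, ∃ X ∈ skewAdjoint 𝐌,
      exp X = (φ : ℂ) • (U * star V) ∧ ‖X‖ ≤ Real.pi / 2 * a := by
  obtain ⟨ψ, hψ⟩ := exists_lt_of_ciInf_lt h
  have hnorm : ‖((ψ⁻¹ : Circle) : ℂ) • (U * star V) - 1‖ < a := by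
    rw [← smul_mul_assoc, norm_mul_star_sub_one hV]
    calc ‖((ψ⁻¹ : Circle) : ℂ) • U - V‖ = ‖((ψ⁻¹ : Circle) : ℂ) • (U - (ψ : ℂ) • V)‖ := by
          rw [smul_sub, circle_inv_smul_smul]
      _ = ‖U - (ψ : ℂ) • V‖ := by rw [norm_smul, Circle.norm_coe, one_mul]
      _ < a := (norm_sub_le_idist hU (circle_smul_mem_unitary ψ hV)).trans_lt hψ
  obtain ⟨X, hX, hle, hexp⟩ := exists_exp_eq_of_norm_sub_one_lt
    (circle_smul_mem_unitary ψ⁻¹ (mul_mem hU (Unitary.star_mem hV))) (hnorm.trans_le ha)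
  exact ⟨ψ⁻¹, X, hX, hexp, hle.trans (by gcongr)⟩

theorem pdist_projRoot_mul_le (hZ : Z ∈ unitary 𝐌) (hV : V ∈ unitary 𝐌)
    (hW : IsProjRoot p U W) : pdist Z (W * V) ≤ pdist Z V + Real.pi / p := by
  obtain ⟨φ, -, X, hX, hlt, -, rfl⟩ := hW
  have hroot : ‖(1 / (p : ℝ)) • X‖ ≤ Real.pi / p := by
    rw [norm_smul, Real.norm_of_nonneg (by positivity), one_div, inv_mul_eq_div]
    gcongr
  exact (pdist_exp_mul_le (skewAdjoint.smul_mem _ hX) hZ hV).trans (by gcongr)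

theorem pdist_projRoot_one (Z : 𝐌) (hW : IsProjRoot 1 U W) : pdist Z W = pdist Z U := by
  obtain ⟨φ, -, X, -, -, hexp, rfl⟩ := hW
  rw [Nat.cast_one, div_one, one_smul, hexp, pdist_smul_right]

theorem exists_log_of_isProjRoot (hW : IsProjRoot p U W) (hU : pdist 1 U < 1 / (3 * Real.pi)) :
    ∃ φ : Circle, ∃ Y ∈ skewAdjoint 𝐌, exp Y = (φ : ℂ) • U ∧ W = exp ((1 / (p : ℝ)) • Y) ∧
      ‖Y‖ ≤ 1 / 6 := by
  obtain ⟨φ, hφ, Y, hY, hlt, hexp, hroot⟩ := hW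
  refine ⟨φ, Y, hY, hexp, hroot, ?_⟩
  have hdist : ‖exp Y - 1‖ ≤ 1 / (3 * Real.pi) := by
    rw [norm_sub_rev]
    refine (norm_sub_le_idist (one_mem _) (exp_mem_unitary hY)).trans ?_
    rw [hexp]
    exact (hφ hU).le
  calc ‖Y‖ ≤ Real.pi / 2 * ‖exp Y - 1‖ := norm_le_half_pi_mul_norm_exp_sub_one hY hlt.le
    _ ≤ Real.pi / 2 * (1 / (3 * Real.pi)) := by gcongr
    _ = 1 / 6 := by field_simp; norm_num

theorem pdist_one_exp_le (hX : X ∈ skewAdjoint 𝐌) : pdist 1 (exp X) ≤ ‖X‖ := by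
  simpa using (pdist_le_idist _ _).trans (idist_exp_mul_le hX (one_mem (unitary 𝐌)))

theorem pdist_mul_le_pdist_mul_star (hZ : Z ∈ unitary 𝐌) (hV : V ∈ unitary 𝐌)
    (hW : W ∈ unitary 𝐌) : pdist Z (W * V) ≤ pdist (Z * star V) W := by
  simpa only [mul_star_mul_cancel_right hV] using
    pdist_mul_right_le (mul_mem hZ (Unitary.star_mem hV)) hW hV

theorem pdist_projRoot_exp_lt (hX : X ∈ skewAdjoint 𝐌) (hU : U ∈ unitary 𝐌) (hp : 0 < p)
    (hXp : ‖(p : ℝ) • X‖ ≤ 0.063) (h : pdist (exp ((p : ℝ) • X)) U ≤ 1 / 200)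
    (hW : IsProjRoot p U W) : pdist W (exp X) < 0.02 / p := by
  have hpX := skewAdjoint.smul_mem (p : ℝ) hX
  have hthird : (0.07 : ℝ) < 1 / (3 * Real.pi) := by
    rw [lt_div_iff₀ (by positivity)]
    linarith [Real.pi_lt_d2]
  have hnear : pdist 1 U < 1 / (3 * Real.pi) := by
    have := pdist_triangle (one_mem _) (exp_mem_unitary hpX) hU
    linarith [pdist_one_exp_le hpX]
  obtain ⟨φ, Y, hY, hexp, rfl, hYn⟩ := exists_log_of_isProjRoot hW hnear
  have hdist : pdist (exp Y) (exp ((p : ℝ) • X)) < 0.006 := by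
    rw [pdist_comm (exp_mem_unitary hY) (exp_mem_unitary hpX), hexp, pdist_smul_right]
    linarith
  obtain ⟨a, ha⟩ := exists_norm_phase_add_sub_mul_le hpX hY hdist
  have hle : ‖((a : ℂ) * Complex.I) • (1 : 𝐌) + (p : ℝ) • X - Y‖ ≤ 0.015 := by
    have hfactor : (0.4 : ℝ) ≤ 1 - Real.pi / 2 * (‖(p : ℝ) • X‖ + ‖Y‖ + 0.006) -
        (‖(p : ℝ) • X‖ + ‖Y‖) := by
      nlinarith [Real.pi_lt_d4, Real.pi_pos]
    nlinarith [norm_nonneg (((a : ℂ) * Complex.I) • (1 : 𝐌) + (p : ℝ) • X - Y)]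
  refine (pdist_exp_one_div_smul_le hX hY hp a).trans_lt ?_
  gcongr
  linarith

theorem pdist_projRoot_mul_lt (hZ : Z ∈ unitary 𝐌) (hU : U ∈ unitary 𝐌) (hV : V ∈ unitary 𝐌)
    (hW : W ∈ unitary 𝐌) (hp : 0 < p) (hroot : IsProjRoot p U W) (hZV : pdist Z V < 0.04 / p)
    (hpow : pdist ((Z * star V) ^ p) U ≤ 1 / 200) : pdist Z (W * V) < 0.02 / p := by
  have hS : Z * star V ∈ unitary 𝐌 := mul_mem hZ (Unitary.star_mem hV)
  have hsmall : 0.04 / (p : ℝ) ≤ 2 :=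
    (div_le_self (by norm_num) (by exact_mod_cast hp)).trans (by norm_num)
  obtain ⟨φ, X, hX, hexp, hnorm⟩ := exists_exp_eq_circle_smul_mul_star hZ hV hZV hsmall
  have hpX : ‖(p : ℝ) • X‖ ≤ 0.063 := by
    rw [norm_smul, Real.norm_of_nonneg (by positivity)]
    calc (p : ℝ) * ‖X‖ ≤ p * (Real.pi / 2 * (0.04 / p)) := by gcongr
      _ = Real.pi / 2 * 0.04 := by field_simp
      _ ≤ 0.063 := by linarith [Real.pi_lt_d2]
  have hexp_pow : exp ((p : ℝ) • X) = ((φ ^ p : Circle) : ℂ) • (Z * star V) ^ p := by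
    let +nondep : NormedAlgebra ℚ 𝐌 := .restrictScalars ℚ ℂ 𝐌
    rw [Nat.cast_smul_eq_nsmul, exp_nsmul, hexp, smul_pow, Circle.coe_pow]
  have hdist : pdist (exp ((p : ℝ) • X)) U ≤ 1 / 200 := by
    have hSp := pow_mem hS p
    rwa [hexp_pow, pdist_comm (circle_smul_mem_unitary _ hSp) hU, pdist_smul_right,
      pdist_comm hU hSp]
  calc pdist Z (W * V) ≤ pdist (Z * star V) W := pdist_mul_le_pdist_mul_star hZ hV hW
    _ = pdist W (exp X) := by rw [hexp, pdist_smul_right, pdist_comm hS hW]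
    _ < 0.02 / p := pdist_projRoot_exp_lt hX hU hp hpX hdist hroot

/-- `V` is a good enough estimate of `Z` to enter round `m` of the bootstrap. Nothing is required
before round `0`, whose exponent is `1`. -/
def Tracks (Z : UU d) (m : ℕ) (V : UU d) : Prop :=
  m ≠ 0 → pdist (Z : 𝐌) V < 0.04 / 2 ^ m

theorem Tracks.pdist_le {Z V : UU d} {m : ℕ} (h : Tracks Z m V) :
    pdist (Z : 𝐌) V ≤ Real.pi / 2 ^ m := by
  rcases eq_or_ne m 0 with rfl | hm
  · simpa using pdist_le_pi Z.2 V.2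
  · refine (h hm).le.trans ?_
    gcongr
    linarith [Real.pi_gt_three]

theorem Tracks.succ {root : ℕ → UU d → UU d} (hroot : IsRootRule root) {Z V U : UU d} {m : ℕ}
    (h : Tracks Z m V) (hU : pdist (((Z * V⁻¹) ^ 2 ^ m : UU d) : 𝐌) U ≤ 1 / 200) :
    Tracks Z (m + 1) (root (2 ^ m) U * V) := by
  have hW := hroot.isProjRoot (2 ^ m) Nat.one_le_two_pow U
  suffices hlt : pdist (Z : 𝐌) (root (2 ^ m) U * V : 𝐌) < 0.02 / (2 ^ m : ℕ) by
    refine fun _ => hlt.trans_eq ?_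
    push_cast
    ring
  rcases eq_or_ne m 0 with rfl | hm
  · rw [pow_zero, pow_one] at hU
    calc pdist (Z : 𝐌) (root 1 U * V : 𝐌) ≤ pdist (Z * star V : 𝐌) (root 1 U) :=
          pdist_mul_le_pdist_mul_star Z.2 V.2 (root 1 U).2
      _ = pdist (Z * star V : 𝐌) U := pdist_projRoot_one _ hW
      _ ≤ 1 / 200 := hU
      _ < 0.02 / (2 ^ 0 : ℕ) := by norm_num
  · exact pdist_projRoot_mul_lt Z.2 U.2 V.2 (root (2 ^ m) U).2 (by positivity) hW
      (by simpa using h hm) hU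

end Round

/-! ### Output distributions of programs -/

namespace Prog

open scoped ComplexOrder

variable {d k : ℕ}

theorem trace_re_nonneg {ρ : Op d k} (hρ : ρ.PosSemidef) : 0 ≤ ρ.trace.re :=
  (Complex.le_def.1 hρ.trace_nonneg).1

theorem sum_trace_kraus {m : ℕ} {K : Fin m → Op d k} (hK : ∑ i, (K i)ᴴ * K i = 1) (ρ : Op d k) :
    ∑ i, (K i * ρ * (K i)ᴴ).trace = ρ.trace :=
  calc ∑ i, (K i * ρ * (K i)ᴴ).trace = ∑ i, ((K i)ᴴ * K i * ρ).trace :=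
        Finset.sum_congr rfl fun i _ => by rw [Matrix.trace_mul_comm, mul_assoc]
    _ = ρ.trace := by rw [← Matrix.trace_sum, ← Finset.sum_mul, hK, one_mul]

theorem trace_conj_onQudit (Z : UU d) (ρ : Op d k) :
    (onQudit k Z * ρ * (onQudit k Z)ᴴ).trace = ρ.trace := by
  rw [Matrix.trace_mul_comm, ← mul_assoc, onQudit_isometry, one_mul]

theorem run_univ (Z : UU d) (P : Prog d k) {ρ : Op d k} (hρ : ρ.PosSemidef) :
    P.run Z ρ Set.univ = ENNReal.ofReal ρ.trace.re := by
  induction P generalizing ρ with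
  | output U => simp [run]
  | query next ih => rw [run, ih (hρ.mul_mul_conjTranspose_same _), trace_conj_onQudit]
  | instrument K hK next ih =>
    have hpos i := hρ.mul_mul_conjTranspose_same (K i)
    rw [run, Measure.finsetSum_apply, Finset.sum_congr rfl fun i _ => ih i (hpos i),
      ← ENNReal.ofReal_sum_of_nonneg fun i _ => trace_re_nonneg (hpos i),
      ← Complex.re_sum, sum_trace_kraus hK]

theorem run_smul (Z : UU d) (P : Prog d k) {c : ℝ} (hc : 0 ≤ c) (ρ : Op d k) :
    P.run Z (c • ρ) = ENNReal.ofReal c • P.run Z ρ := by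
  induction P generalizing ρ with
  | output U =>
    rw [run, run, smul_smul, ← ENNReal.ofReal_mul hc, Matrix.trace_smul, Complex.smul_re,
      smul_eq_mul]
  | query next ih => rw [run, run, mul_smul_comm, smul_mul_assoc, ih]
  | instrument K hK next ih =>
    simp only [run, mul_smul_comm, smul_mul_assoc, ih, Finset.smul_sum]

section Initial

variable [NeZero d]

theorem trace_initial : (initial d k).trace = 1 := Matrix.trace_single_eq_same _ _

theorem posSemidef_initial : (initial d k).PosSemidef := by
  have h : initial d k = initial d k * (initial d k)ᴴ := by
    simp [initial, Matrix.conjTranspose_single]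
  rw [h]
  exact Matrix.posSemidef_self_mul_conjTranspose _

instance (P : Prog d k) (Z : UU d) : IsProbabilityMeasure (P.out Z) :=
  ⟨by rw [out, run_univ Z P posSemidef_initial, trace_initial, Complex.one_re, ENNReal.ofReal_one]⟩

theorem out_output (Z V : UU d) : (output V : Prog d k).out Z = Measure.dirac V := by
  rw [out, run, trace_initial, Complex.one_re, ENNReal.ofReal_one, one_smul]

theorem resetKraus_mul_mul {ρ : Op d k} (hρ : ρ.PosSemidef) (i : Fin (d * (k + 1))) :
    resetKraus d k i * ρ * (resetKraus d k i)ᴴ =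
      (ρ (finProdFinEquiv.symm i) (finProdFinEquiv.symm i)).re • initial d k := by
  have hre : ρ (finProdFinEquiv.symm i) (finProdFinEquiv.symm i) =
      ((ρ (finProdFinEquiv.symm i) (finProdFinEquiv.symm i)).re : ℂ) :=
    Complex.eq_re_of_ofReal_le hρ.diag_nonneg
  rw [resetKraus, Matrix.conjTranspose_single, star_one, Matrix.single_mul_mul_single, one_mul,
    mul_one, hre, initial, Matrix.smul_single, Complex.real_smul, mul_one, Complex.ofReal_re]

theorem run_reset (Z : UU d) (P : Prog d k) {ρ : Op d k} (hρ : ρ.PosSemidef) :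
    (reset P).run Z ρ = ENNReal.ofReal ρ.trace.re • P.out Z := by
  have hdiag (x : Reg d k) : 0 ≤ (ρ x x).re := (Complex.le_def.1 hρ.diag_nonneg).1
  let run₀ (x : Reg d k) : Measure (UU d) := P.run Z ((ρ x x).re • initial d k)
  calc (reset P).run Z ρ = ∑ i, run₀ (finProdFinEquiv.symm i) :=
        Finset.sum_congr rfl fun i _ => by rw [resetKraus_mul_mul hρ]
    _ = ∑ x, run₀ x := Equiv.sum_comp finProdFinEquiv.symm run₀
    _ = ∑ x : Reg d k, ENNReal.ofReal (ρ x x).re • P.out Z :=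
        Finset.sum_congr rfl fun x _ => run_smul Z P (hdiag x) _
    _ = ENNReal.ofReal ρ.trace.re • P.out Z := by
        rw [← Finset.sum_smul, ← ENNReal.ofReal_sum_of_nonneg fun x _ => hdiag x, ← Complex.re_sum]
        rfl

theorem lintegral_run_bind (Z : UU d) (g : UU d → Prog d k) (P : Prog d k) {ρ : Op d k}
    (hρ : ρ.PosSemidef) (F : UU d → ENNReal) :
    ∫⁻ U, F U ∂((P.bind g).run Z ρ) = ∫⁻ U, ∫⁻ W, F W ∂((g U).out Z) ∂(P.run Z ρ) := by
  induction P generalizing ρ with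
  | output U =>
    rw [bind, run_reset Z _ hρ, run, lintegral_smul_measure, lintegral_smul_measure,
      lintegral_dirac]
  | query _ ih => exact ih (hρ.mul_mul_conjTranspose_same _)
  | instrument K hK next ih =>
    rw [bind, run, run, lintegral_finsetSum_measure, lintegral_finsetSum_measure]
    exact Finset.sum_congr rfl fun i _ => ih i (hρ.mul_mul_conjTranspose_same (K i))

theorem out_bind (Z : UU d) {g : UU d → Prog d k} (hg : Measurable fun U => (g U).out Z)
    (P : Prog d k) : (P.bind g).out Z = (P.out Z).bind fun U => (g U).out Z := by
  ext B hB
  rw [Measure.bind_apply hB hg.aemeasurable, ← lintegral_indicator_one hB]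
  exact (lintegral_run_bind Z g P posSemidef_initial _).trans
    (lintegral_congr fun U => lintegral_indicator_one hB)

end Initial

theorem onQudit_mul (U V : UU d) : onQudit k (U * V) = onQudit k U * onQudit k V := by
  simp only [onQudit, Submonoid.coe_mul]
  rw [← Matrix.mul_kronecker_mul, mul_one]

theorem onQudit_one : onQudit k (1 : UU d) = 1 := Matrix.one_kronecker_one

theorem run_queryPow (Z V : UU d) (p : ℕ) (P : Prog d k) (ρ : Op d k) :
    (queryPow V p P).run Z ρ =
      P.run Z (onQudit k ((Z * V⁻¹) ^ p) * ρ * (onQudit k ((Z * V⁻¹) ^ p))ᴴ) := by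
  induction p generalizing ρ with
  | zero => simp [queryPow, onQudit_one]
  | succ p ih =>
    rw [queryPow, gate, run, Fin.sum_univ_one, run, ih, pow_succ, onQudit_mul, onQudit_mul]
    simp only [Matrix.conjTranspose_mul, mul_assoc]

theorem run_withOracle (Z V : UU d) (p : ℕ) (P : Prog d k) (ρ : Op d k) :
    (P.withOracle V p).run Z ρ = P.run ((Z * V⁻¹) ^ p) ρ := by
  induction P generalizing ρ with
  | output U => rfl
  | query next ih => rw [withOracle, run_queryPow, ih, run]
  | instrument K hK next ih => simp only [withOracle, run, ih]

theorem out_withOracle [NeZero d] (Z V : UU d) (p : ℕ) (P : Prog d k) :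
    (P.withOracle V p).out Z = P.out ((Z * V⁻¹) ^ p) := run_withOracle Z V p P _

theorem continuous_onQudit : Continuous (onQudit k : UU d → Op d k) := by
  refine continuous_matrix fun i j => ?_
  simp only [onQudit, Matrix.kroneckerMap_apply]
  exact (continuous_subtype_val.matrix_elem _ _).mul continuous_const

theorem continuous_run (P : Prog d k) (B : Set (UU d)) :
    Continuous fun x : UU d × Op d k => P.run x.1 x.2 B := by
  induction P with
  | output U =>
    simp only [run, Measure.smul_apply, smul_eq_mul]
    exact (ENNReal.continuous_mul_const (measure_ne_top _ _)).comp
      (ENNReal.continuous_ofReal.comp (Complex.continuous_re.comp continuous_snd.matrix_trace))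
  | query next ih =>
    have h : Continuous fun x : UU d × Op d k => onQudit k x.1 :=
      continuous_onQudit.comp continuous_fst
    exact ih.comp (continuous_fst.prodMk
      ((h.matrix_mul continuous_snd).matrix_mul h.matrix_conjTranspose))
  | instrument K hK next ih =>
    simp only [run, Measure.finsetSum_apply]
    exact continuous_finsetSum _ fun i _ => (ih i).comp (continuous_fst.prodMk
      ((continuous_const.matrix_mul continuous_snd).matrix_mul continuous_const))

theorem continuous_out [NeZero d] (P : Prog d k) (B : Set (UU d)) :
    Continuous fun Z : UU d => P.out Z B :=
  (continuous_run P B).comp (continuous_id.prodMk continuous_const)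

/-! ### Query counts -/

theorem queries_instrument_le {m : ℕ} {K : Fin m → Op d k} {hK : ∑ i, (K i)ᴴ * K i = 1}
    {next : Fin m → Prog d k} {b : ℕ} :
    (instrument K hK next).queries ≤ b ↔ ∀ i, (next i).queries ≤ b := by
  simp [queries]

theorem queries_bind_le [NeZero d] (P : Prog d k) {g : UU d → Prog d k} {b : ℕ}
    (hg : ∀ U, (g U).queries ≤ b) : (P.bind g).queries ≤ P.queries + b := by
  induction P with
  | output U => exact queries_instrument_le.2 fun _ => (hg U).trans (Nat.le_add_left _ _)
  | query next ih => rw [bind, queries, queries]; omega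
  | instrument K hK next ih =>
    exact queries_instrument_le.2 fun i =>
      (ih i).trans (Nat.add_le_add_right (queries_instrument_le.1 le_rfl i) _)

theorem queries_queryPow (V : UU d) (p : ℕ) (P : Prog d k) :
    (queryPow V p P).queries = p + P.queries := by
  induction p with
  | zero => rw [queryPow, zero_add]
  | succ p ih =>
    simp only [queryPow, gate, queries, ih, Finset.sup_const Finset.univ_nonempty]; ring

theorem queries_withOracle_le (V : UU d) (p : ℕ) (P : Prog d k) :
    (P.withOracle V p).queries ≤ p * P.queries := by
  induction P with
  | output U => exact Nat.zero_le _
  | query next ih => rw [withOracle, queries_queryPow, queries, Nat.mul_add]; omega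
  | instrument K hK next ih =>
    exact queries_instrument_le.2 fun i =>
      (ih i).trans (Nat.mul_le_mul_left _ (queries_instrument_le.1 le_rfl i))

theorem queries_runAll_le [NeZero d] {n : ℕ} {P : Fin n → Prog d k}
    {g : (Fin n → UU d) → Prog d k} {a b : ℕ} (hP : ∀ i, (P i).queries ≤ a)
    (hg : ∀ u, (g u).queries ≤ b) : (runAll P g).queries ≤ n * a + b := by
  induction n with
  | zero => simpa [runAll] using hg _
  | succ n ih =>
    calc (runAll P g).queries ≤ (P 0).queries + (n * a + b) :=
          queries_bind_le (P 0) fun U => ih (fun i => hP i.succ) fun u => hg _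
      _ ≤ (n + 1) * a + b := by linarith [hP 0]

end Prog

/-! ### Products and mixtures of measures -/

section Pi

open ProbabilityTheory

theorem measurable_finCons {α : Type*} [MeasurableSpace α] {n : ℕ} {X : Fin (n + 1) → Type*}
    [∀ i, MeasurableSpace (X i)] {f : α → X 0} {g : α → ∀ i : Fin n, X i.succ}
    (hf : Measurable f) (hg : Measurable g) :
    Measurable fun a => (Fin.cons (f a) (g a) : ∀ i, X i) :=
  measurable_pi_lambda _ <| Fin.cases hf fun i => (measurable_pi_apply i).comp hg

theorem pi_bind_fin_succ {n : ℕ} {X : Fin (n + 1) → Type*} [∀ i, MeasurableSpace (X i)]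
    {β : Type*} [MeasurableSpace β] (μ : ∀ i, Measure (X i)) [∀ i, SigmaFinite (μ i)]
    {f : (∀ i, X i) → Measure β} (hf : Measurable f) :
    (Measure.pi μ).bind f =
      (μ 0).bind fun a =>
        (Measure.pi fun j : Fin n => μ j.succ).bind fun y => f (Fin.cons a y) := by
  have hsplit := (measurePreserving_piFinSuccAbove μ 0).symm
  have hcons (x : X 0 × ∀ j : Fin n, X j.succ) :
      (MeasurableEquiv.piFinSuccAbove X 0).symm x = Fin.cons x.1 x.2 := by
    simp only [MeasurableEquiv.piFinSuccAbove, Fin.insertNthEquiv_zero]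
    rfl
  have hfcons : Measurable fun x : X 0 × ∀ j : Fin n, X j.succ => f (Fin.cons x.1 x.2) :=
    hf.comp (measurable_finCons measurable_fst measurable_snd)
  have htail (a : X 0) : Measurable fun y : ∀ j : Fin n, X j.succ => f (Fin.cons a y) :=
    hfcons.comp measurable_prodMk_left
  have hhead : Measurable fun a : X 0 =>
      (Measure.pi fun j : Fin n => μ j.succ).bind fun y => f (Fin.cons a y) := by
    refine Measure.measurable_of_measurable_coe _ fun B hB => ?_
    simp only [Measure.bind_apply hB (htail _).aemeasurable]
    exact ((Measure.measurable_coe hB).comp hfcons).lintegral_prod_right'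
  ext B hB
  have hfB : Measurable fun x => f x B := (Measure.measurable_coe hB).comp hf
  have hfconsB : Measurable fun x : X 0 × ∀ j : Fin n, X j.succ => f (Fin.cons x.1 x.2) B :=
    (Measure.measurable_coe hB).comp hfcons
  rw [Measure.bind_apply hB hf.aemeasurable, Measure.bind_apply hB hhead.aemeasurable,
    ← hsplit.lintegral_comp hfB]
  simp only [Measure.bind_apply hB (htail _).aemeasurable]
  exact (lintegral_congr fun x => congrArg (f · B) (hcons x)).trans
    (lintegral_prod _ hfconsB.aemeasurable)

theorem bind_comm {α β γ : Type*} [MeasurableSpace α] [MeasurableSpace β] [MeasurableSpace γ]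
    (μ : Measure α) [SFinite μ] (ν : Measure β) [SFinite ν] {f : α → β → Measure γ}
    (hf : Measurable (Function.uncurry f)) :
    (μ.bind fun a => ν.bind (f a)) = ν.bind fun b => μ.bind fun a => f a b := by
  have hfa (a : α) : Measurable (f a) := hf.comp measurable_prodMk_left
  have hfb (b : β) : Measurable fun a => f a b := hf.comp measurable_prodMk_right
  have hleft : Measurable fun a => ν.bind (f a) := by
    refine Measure.measurable_of_measurable_coe _ fun B hB => ?_
    simp only [Measure.bind_apply hB (hfa _).aemeasurable]
    exact ((Measure.measurable_coe hB).comp hf).lintegral_prod_right'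
  have hright : Measurable fun b => μ.bind fun a => f a b := by
    refine Measure.measurable_of_measurable_coe _ fun B hB => ?_
    simp only [Measure.bind_apply hB (hfb _).aemeasurable]
    exact ((Measure.measurable_coe hB).comp hf).lintegral_prod_left'
  ext B hB
  rw [Measure.bind_apply hB hleft.aemeasurable, Measure.bind_apply hB hright.aemeasurable]
  simp only [Measure.bind_apply hB (hfa _).aemeasurable, Measure.bind_apply hB (hfb _).aemeasurable]
  exact lintegral_lintegral_swap ((Measure.measurable_coe hB).comp hf).aemeasurable

theorem measurable_bind_of_uncurry {α β γ : Type*} [MeasurableSpace α] [MeasurableSpace β]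
    [MeasurableSpace γ] {κ : α → Measure β} [∀ a, IsProbabilityMeasure (κ a)] (hκ : Measurable κ)
    {η : α → β → Measure γ} (hη : Measurable (Function.uncurry η)) :
    Measurable fun a => (κ a).bind (η a) := by
  let kernel : Kernel α β := ⟨κ, hκ⟩
  have : IsMarkovKernel kernel := ⟨fun a => inferInstanceAs (IsProbabilityMeasure (κ a))⟩
  refine Measure.measurable_of_measurable_coe _ fun B hB => ?_
  have hηa (a : α) : Measurable (η a) := hη.comp measurable_prodMk_left
  simp only [Measure.bind_apply hB (hηa _).aemeasurable]
  exact ((Measure.measurable_coe hB).comp hη).lintegral_kernel_prod_right' (κ := kernel)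

variable {ι : Type*} [Fintype ι] {X Y : ι → Type*} [∀ i, MeasurableSpace (X i)]
  [∀ i, MeasurableSpace (Y i)]

theorem measurable_pi_measure {α : Type*} [MeasurableSpace α] {κ : ∀ i, α → Measure (Y i)}
    [∀ i a, IsProbabilityMeasure (κ i a)] (hκ : ∀ i, Measurable (κ i)) :
    Measurable fun a => Measure.pi fun i => κ i a := by
  refine Measurable.measure_of_isPiSystem_of_isProbabilityMeasure generateFrom_pi.symm
    isPiSystem_pi ?_
  rintro _ ⟨s, hs, rfl⟩
  simp only [Measure.pi_pi]
  exact Finset.measurable_fun_prod _ fun i _ =>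
    (Measure.measurable_coe (hs i trivial)).comp (hκ i)

theorem pi_bind_pi (μ : ∀ i, Measure (X i)) [∀ i, IsProbabilityMeasure (μ i)]
    {κ : ∀ i, X i → Measure (Y i)} [∀ i x, IsProbabilityMeasure (κ i x)]
    (hκ : ∀ i, Measurable (κ i)) :
    (Measure.pi μ).bind (fun x => Measure.pi fun i => κ i (x i)) =
      Measure.pi fun i => (μ i).bind (κ i) := by
  have hprob (i : ι) : IsProbabilityMeasure ((μ i).bind (κ i)) :=
    isProbabilityMeasure_bind (hκ i).aemeasurable (ae_of_all _ fun _ => inferInstance)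
  refine (Measure.pi_eq fun s hs => ?_).symm
  have hκs (i : ι) : Measurable fun x => κ i x (s i) :=
    (Measure.measurable_coe (hs i)).comp (hκ i)
  have hpi : Measurable fun x : ∀ i, X i => Measure.pi fun i => κ i (x i) :=
    measurable_pi_measure fun i => (hκ i).comp (measurable_pi_apply i)
  rw [Measure.bind_apply (.univ_pi hs) hpi.aemeasurable]
  simp only [Measure.pi_pi]
  rw [lintegral_prod_eq_prod_lintegral_of_indepFun _ _
    (iIndepFun_pi fun i => (hκs i).aemeasurable) fun i => (hκs i).comp (measurable_pi_apply i)]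
  refine Finset.prod_congr rfl fun i _ => ?_
  rw [Measure.bind_apply (hs i) (hκ i).aemeasurable]
  exact (measurePreserving_eval μ i).lintegral_comp (hκs i)

end Pi

/-! ### The law of the main loop as a Markov chain -/

namespace Prog

variable {d k : ℕ} [NeZero d]

theorem out_runAll {n : ℕ} (Z : UU d) (P : Fin n → Prog d k) {g : (Fin n → UU d) → Prog d k}
    (hg : Measurable fun u => (g u).out Z) :
    (runAll P g).out Z = (Measure.pi fun i => (P i).out Z).bind fun u => (g u).out Z := by
  induction n with
  | zero =>
    rw [Measure.pi_of_empty, Measure.dirac_bind hg, runAll]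
    congr!
  | succ n ih =>
    have htail (U : UU d) : Measurable fun u : Fin n → UU d => (g (Fin.cons U u)).out Z :=
      hg.comp (measurable_finCons measurable_const measurable_id)
    have hrunAll : Measurable fun U => (runAll (Fin.tail P) fun u => g (Fin.cons U u)).out Z := by
      simp only [ih (Fin.tail P) (htail _)]
      exact measurable_bind_of_uncurry measurable_const
        (hg.comp (measurable_finCons measurable_fst measurable_snd))
    rw [runAll, out_bind Z hrunAll, pi_bind_fin_succ _ hg]
    simp only [ih (Fin.tail P) (htail _)]
    rfl

theorem measurable_out_runAll {α : Type*} [MeasurableSpace α] {n : ℕ} (Z : UU d)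
    {P : α → Fin n → Prog d k} {g : α → (Fin n → UU d) → Prog d k}
    (hP : ∀ i, Measurable fun a => (P a i).out Z)
    (hg : Measurable fun x : α × (Fin n → UU d) => (g x.1 x.2).out Z) :
    Measurable fun a => (runAll (P a) (g a)).out Z := by
  have hga (a : α) : Measurable fun u => (g a u).out Z := hg.comp measurable_prodMk_left
  simp only [out_runAll Z _ (hga _)]
  exact measurable_bind_of_uncurry (measurable_pi_measure hP) hg

end Prog

section Measurability

variable {d : ℕ}

theorem measurableSet_isCentral {n : ℕ} (r : ℝ) (i : Fin n) :
    MeasurableSet {u : Fin n → UU d | IsCentral r u i} := by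
  classical
  have hpair (j : Fin n) : Measurable fun u : Fin n → UU d => (u i, u j) :=
    (measurable_pi_apply i).prodMk (measurable_pi_apply j)
  have hdist (j : Fin n) :
      Measurable fun u : Fin n → UU d => pdist (u i : Matrix (Fin d) (Fin d) ℂ) (u j) := by
    simpa only [Function.comp_def] using measurable_pdist.comp (hpair j)
  have hcard (u : Fin n → UU d) :
      ({j : Fin n | pdist (u i : Matrix (Fin d) (Fin d) ℂ) (u j) ≤ r}.ncard : ℝ) =
        ∑ j, if pdist (u i : Matrix (Fin d) (Fin d) ℂ) (u j) ≤ r then (1 : ℝ) else 0 := by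
    rw [Finset.sum_boole, ← Set.ncard_coe_finset]
    simp
  simp only [IsCentral, hcard]
  exact measurableSet_le measurable_const (Finset.measurable_fun_sum _ fun j _ =>
    Measurable.ite (measurableSet_le (hdist j) measurable_const) measurable_const measurable_const)

theorem measurable_central {n : ℕ} (r : ℝ) :
    Measurable (central r : (Fin n → UU d) → UU d) := by
  classical
  let _ : MeasurableSpace (Finset (Fin n)) := ⊤
  let centralIndices (u : Fin n → UU d) : Finset (Fin n) := Finset.univ.filter (IsCentral r u)
  let first (x : Finset (Fin n) × (Fin n → UU d)) : UU d :=
    if h : x.1.Nonempty then x.2 (x.1.min' h) else 1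
  have hindices : Measurable centralIndices := by
    refine measurable_to_countable' fun s => ?_
    have hpre : centralIndices ⁻¹' {s} = ⋂ i, {u | IsCentral r u i ↔ i ∈ s} := by
      ext u
      simp [centralIndices, Finset.ext_iff]
    rw [hpre]
    exact MeasurableSet.iInter fun i => (measurableSet_isCentral r i).iff (.const _)
  have hfirst : Measurable first := by
    refine measurable_from_prod_countable_right fun s => ?_
    by_cases h : s.Nonempty
    · simpa only [first, h, dif_pos] using measurable_pi_apply (X := fun _ : Fin n => UU d) _
    · simp only [first, h, dif_neg, not_false_eq_true, measurable_const]
  exact hfirst.comp (hindices.prodMk measurable_id)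

theorem measurable_root_central {root : ℕ → UU d → UU d} (hroot : ∀ p, Measurable (root p))
    (r : ℝ) (p n : ℕ) : Measurable fun u : Fin n → UU d => root p (central r u) :=
  (hroot p).comp (measurable_central r)

variable [NeZero d] {A : Estimator d}

theorem Estimator.IsMeasurable.isProbabilityMeasure_law (hA : A.IsMeasurable) (Z : UU d) :
    IsProbabilityMeasure (A.law Z) :=
  isProbabilityMeasure_bind (hA Z).aemeasurable (ae_of_all _ fun _ => inferInstance)

theorem Estimator.IsMeasurable.measurable_out (hA : A.IsMeasurable) :
    Measurable fun x : A.Seed × UU d => (A.prog x.1).out x.2 := by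
  refine Measure.measurable_of_measurable_coe _ fun B hB => ?_
  exact (measurable_uncurry_of_continuous_of_measurable
    (u := fun (O : UU d) (s : A.Seed) => (A.prog s).out O B)
    (fun s => Prog.continuous_out (A.prog s) B)
    fun O => (Measure.measurable_coe hB).comp (hA O)).comp measurable_swap

theorem measurable_out_bootLoop (hA : A.IsMeasurable) {root : ℕ → UU d → UU d}
    (hroot : ∀ p, Measurable (root p)) (r : ℝ) (Z : UU d) {n : ℕ} (p N : Fin n → ℕ) :
    Measurable fun x : ((j : Fin n) → Fin (N j) → A.Seed) × UU d =>
      (bootLoop A root r p N x.1 x.2).out Z := by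
  induction n with
  | zero =>
    simp only [bootLoop, Prog.out_output]
    exact Measure.measurable_dirac.comp measurable_snd
  | succ n ih =>
    simp only [bootLoop]
    refine Prog.measurable_out_runAll Z (fun i => ?_) ?_
    · simp only [Prog.out_withOracle]
      have hseed : Measurable fun x : ((j : Fin (n + 1)) → Fin (N j) → A.Seed) × UU d => x.1 0 i :=
        (measurable_pi_apply i).comp ((measurable_pi_apply 0).comp measurable_fst)
      exact hA.measurable_out.comp
        (hseed.prodMk ((measurable_const.mul measurable_snd.inv).pow_const _))
    · have htail : Measurable fun x : (((j : Fin (n + 1)) → Fin (N j) → A.Seed) × UU d) ×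
          (Fin (N 0) → UU d) => fun j : Fin n => x.1.1 j.succ :=
        measurable_pi_lambda _ fun j =>
          (measurable_pi_apply _).comp (measurable_fst.comp measurable_fst)
      exact (ih _ _).comp (htail.prodMk (((measurable_root_central hroot r (p 0) (N 0)).comp
        measurable_snd).mul (measurable_snd.comp measurable_fst)))

theorem isMeasurable_bootstrap (c : ℝ) (hA : A.IsMeasurable) {root : ℕ → UU d → UU d}
    (hroot : ∀ p, Measurable (root p)) (ε₀ ε η : ℝ) :
    (bootstrap c A root ε₀ ε η).IsMeasurable := fun Z => by
  have hloop := measurable_out_bootLoop hA hroot (2 * ε₀) Z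
    (fun j : Fin (rounds ε + 1) => 2 ^ (j : ℕ)) (fun j => repetitions c ε η j)
  exact hloop.comp (measurable_id.prodMk (measurable_const (a := (1 : UU d))))

end Measurability

section BootLaw

variable {d : ℕ} [NeZero d] {A : Estimator d} {root : ℕ → UU d → UU d} {n : ℕ}

/-- The law of the output of the main loop started with the estimate `V`, when the oracle is `Z`
and the seeds are independent. -/
noncomputable def bootLaw (A : Estimator d) (root : ℕ → UU d → UU d) (r : ℝ) (Z : UU d)
    (p N : Fin n → ℕ) (V : UU d) : Measure (UU d) :=
  (Measure.pi fun j => Measure.pi fun _ : Fin (N j) => A.μ).bind fun s =>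
    (bootLoop A root r p N s V).out Z

theorem bootLaw_zero (r : ℝ) (Z : UU d) (p N : Fin 0 → ℕ) (V : UU d) :
    bootLaw A root r Z p N V = Measure.dirac V := by
  simp only [bootLaw, bootLoop, Prog.out_output, Measure.bind_const, measure_univ, one_smul]

theorem measurable_bootLaw (hA : A.IsMeasurable) (hroot : ∀ p, Measurable (root p)) (r : ℝ)
    (Z : UU d) (p N : Fin n → ℕ) : Measurable (bootLaw A root r Z p N) :=
  measurable_bind_of_uncurry measurable_const
    ((measurable_out_bootLoop hA hroot r Z p N).comp measurable_swap)

theorem out_bootLoop_succ (hA : A.IsMeasurable) (hroot : ∀ p, Measurable (root p)) (r : ℝ)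
    (Z : UU d) (p N : Fin (n + 1) → ℕ) (s : (j : Fin (n + 1)) → Fin (N j) → A.Seed) (V : UU d) :
    (bootLoop A root r p N s V).out Z =
      (Measure.pi fun i => (A.prog (s 0 i)).out ((Z * V⁻¹) ^ p 0)).bind fun u =>
        (bootLoop A root r (fun j => p j.succ) (fun j => N j.succ) (fun j => s j.succ)
          (root (p 0) (central r u) * V)).out Z := by
  have hrest : Measurable fun u : Fin (N 0) → UU d =>
      (bootLoop A root r (fun j => p j.succ) (fun j => N j.succ) (fun j => s j.succ)
        (root (p 0) (central r u) * V)).out Z :=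
    (measurable_out_bootLoop hA hroot r Z (fun j => p j.succ) fun j => N j.succ).comp
      (measurable_const.prodMk
        ((measurable_root_central hroot r (p 0) (N 0)).mul_const V))
  rw [bootLoop, Prog.out_runAll Z _ hrest]
  simp only [Prog.out_withOracle]

theorem bootLaw_succ (hA : A.IsMeasurable) (hroot : ∀ p, Measurable (root p)) (r : ℝ) (Z : UU d)
    (p N : Fin (n + 1) → ℕ) (V : UU d) :
    bootLaw A root r Z p N V =
      (Measure.pi fun _ : Fin (N 0) => A.law ((Z * V⁻¹) ^ p 0)).bind fun u =>
        bootLaw A root r Z (fun j => p j.succ) (fun j => N j.succ)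
          (root (p 0) (central r u) * V) := by
  set O : UU d := (Z * V⁻¹) ^ p 0
  let rest (s : (j : Fin n) → Fin (N j.succ) → A.Seed) (u : Fin (N 0) → UU d) : Measure (UU d) :=
    (bootLoop A root r (fun j => p j.succ) (fun j => N j.succ) s
      (root (p 0) (central r u) * V)).out Z
  let runs (s₀ : Fin (N 0) → A.Seed) : Measure (Fin (N 0) → UU d) :=
    Measure.pi fun i => (A.prog (s₀ i)).out O
  have hstep : Measurable fun u : Fin (N 0) → UU d => root (p 0) (central r u) * V :=
    (measurable_root_central hroot r (p 0) (N 0)).mul_const V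
  have hloop : Measurable fun s => (bootLoop A root r p N s V).out Z :=
    (measurable_out_bootLoop hA hroot r Z p N).comp measurable_prodMk_right
  have hrest : Measurable (Function.uncurry rest) :=
    (measurable_out_bootLoop hA hroot r Z (fun j => p j.succ) fun j => N j.succ).comp
      (measurable_fst.prodMk (hstep.comp measurable_snd))
  have hruns : Measurable runs :=
    measurable_pi_measure fun i => (hA O).comp (measurable_pi_apply i)
  have hnext : Measurable fun u : Fin (N 0) → UU d =>
      bootLaw A root r Z (fun j => p j.succ) (fun j => N j.succ) (root (p 0) (central r u) * V) :=
    (measurable_bootLaw hA hroot r Z (fun j => p j.succ) fun j => N j.succ).comp hstep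
  calc bootLaw A root r Z p N V
      = (Measure.pi fun _ : Fin (N 0) => A.μ).bind fun s₀ =>
          (Measure.pi fun j : Fin n => Measure.pi fun _ : Fin (N j.succ) => A.μ).bind fun s =>
            (runs s₀).bind (rest s) := by
        rw [bootLaw, pi_bind_fin_succ _ hloop]
        simp only [out_bootLoop_succ hA hroot, Fin.cons_zero, Fin.cons_succ]
        rfl
    _ = (Measure.pi fun _ : Fin (N 0) => A.μ).bind fun s₀ => (runs s₀).bind fun u =>
          bootLaw A root r Z (fun j => p j.succ) (fun j => N j.succ)
            (root (p 0) (central r u) * V) := by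
        simp only [bind_comm _ _ hrest]
        rfl
    _ = _ := by
        rw [← Measure.bind_bind hruns.aemeasurable hnext.aemeasurable]
        simp only [runs, Estimator.law]
        rw [pi_bind_pi _ fun _ => hA O]

end BootLaw

/-! ### Central estimates -/

section Central

variable {d n : ℕ}

theorem exists_eq_central {r : ℝ} {u : Fin n → UU d} {i : Fin n} (hi : IsCentral r u i) :
    ∃ j, central r u = u j ∧ IsCentral r u j := by
  classical
  have hne : (Finset.univ.filter (IsCentral r u)).Nonempty := ⟨i, by simpa using hi⟩
  exact ⟨_, dif_pos hne, (Finset.mem_filter.1 (Finset.min'_mem _ hne)).2⟩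

theorem isCentral_of_pdist_le (S : UU d) {r : ℝ} {u : Fin n → UU d}
    (hu : 0.505 * (n : ℝ) ≤ {j | pdist (S : Matrix (Fin d) (Fin d) ℂ) (u j) ≤ r}.ncard)
    {i : Fin n} (hi : pdist (S : Matrix (Fin d) (Fin d) ℂ) (u i) ≤ r) :
    IsCentral (2 * r) u i := by
  refine hu.trans (Nat.cast_le.2 (Set.ncard_le_ncard fun j hj => ?_))
  have htriangle := pdist_triangle (u i).2 S.2 (u j).2
  rw [pdist_comm (u i).2 S.2] at htriangle
  simp only [Set.mem_ofPred_eq] at hj ⊢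
  linarith

/- The estimates near `S` and those near the central estimate are both more than half of all, so
some estimate is near both. -/
theorem pdist_central_le (S : UU d) (hn : 0 < n) {r : ℝ} {u : Fin n → UU d}
    (hu : 0.505 * (n : ℝ) ≤ {j | pdist (S : Matrix (Fin d) (Fin d) ℂ) (u j) ≤ r}.ncard) :
    pdist (S : Matrix (Fin d) (Fin d) ℂ) (central (2 * r) u) ≤ 3 * r := by
  have hn' : (0 : ℝ) < n := Nat.cast_pos.2 hn
  have hinter {s t : Set (Fin n)} (hs : 0.505 * (n : ℝ) ≤ s.ncard)
      (ht : 0.505 * (n : ℝ) ≤ t.ncard) : (s ∩ t).Nonempty := by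
    refine Set.nonempty_inter_of_lt_ncard_add_ncard ?_
    rw [Nat.card_fin, ← Nat.cast_lt (α := ℝ), Nat.cast_add]
    linarith
  obtain ⟨i₀, hi₀, -⟩ := hinter hu hu
  obtain ⟨i, hval, hi⟩ := exists_eq_central (isCentral_of_pdist_le S hu hi₀)
  obtain ⟨j, hjS, hji⟩ := hinter hu hi
  have htriangle := pdist_triangle S.2 (u j).2 (u i).2
  rw [pdist_comm (u j).2 (u i).2] at htriangle
  simp only [Set.mem_ofPred_eq] at hjS hji
  rw [hval]
  linarith

end Central

section Hoeffding

open ProbabilityTheory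

variable {ι X : Type*} [Fintype ι]

theorem sum_indicator_compl_one (G : Set X) (u : ι → X) :
    ∑ i, Gᶜ.indicator (1 : X → ℝ) (u i) = Fintype.card ι - {i | u i ∈ G}.ncard := by
  classical
  have hmissed : ∑ i, Gᶜ.indicator (1 : X → ℝ) (u i) = ({i | u i ∈ G}ᶜ.ncard : ℝ) := by
    simp only [Set.indicator_apply, Pi.one_apply, Finset.sum_boole]
    rw [← Set.ncard_coe_finset]
    congr!
    ext i
    simp
  rw [hmissed, ← Nat.card_eq_fintype_card, ← Set.ncard_add_ncard_compl {i | u i ∈ G}, Nat.cast_add]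
  ring

theorem measureReal_pi_ncard_lt_le [MeasurableSpace X] (ν : Measure X) [IsProbabilityMeasure ν]
    {G : Set X} (hG : MeasurableSet G) {t q : ℝ} (htq : t ≤ q) (hq : q ≤ ν.real G) :
    (Measure.pi fun _ : ι => ν).real {u | ({i | u i ∈ G}.ncard : ℝ) < t * Fintype.card ι} ≤
      Real.exp (-(2 * (q - t) ^ 2 * Fintype.card ι)) := by
  let miss (x : X) : ℝ := Gᶜ.indicator 1 x
  let dev (i : ι) (u : ι → X) : ℝ := miss (u i) - ∫ x, miss x ∂ν
  have hmiss : Measurable miss := measurable_one.indicator hG.compl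
  have hmean : ∫ x, miss x ∂ν = 1 - ν.real G := by
    rw [← probReal_compl_eq_one_sub hG]
    exact integral_indicator_one hG.compl
  have hindep : iIndepFun dev (Measure.pi fun _ : ι => ν) :=
    iIndepFun_pi fun _ => (hmiss.sub_const _).aemeasurable
  have hsub (i : ι) : HasSubgaussianMGF (dev i) ((‖(1 : ℝ) - 0‖₊ / 2) ^ 2)
      (Measure.pi fun _ : ι => ν) := by
    have hone : HasSubgaussianMGF (fun x => miss x - ∫ x, miss x ∂ν) _ ν :=
      hasSubgaussianMGF_of_mem_Icc (a := 0) (b := 1) hmiss.aemeasurable (ae_of_all _ fun x => by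
        by_cases hx : x ∈ G <;> simp [miss, hx])
    have hmap := (measurePreserving_eval (fun _ : ι => ν) i).map_eq
    exact HasSubgaussianMGF.of_map (measurable_pi_apply i).aemeasurable (by rwa [hmap])
  have hsum (u : ι → X) : ∑ i, dev i u = ν.real G * Fintype.card ι - {i | u i ∈ G}.ncard := by
    simp only [dev, miss, Finset.sum_sub_distrib, sum_indicator_compl_one, Finset.sum_const,
      Finset.card_univ, nsmul_eq_mul]
    rw [hmean]
    ring
  have hdev := HasSubgaussianMGF.measure_sum_ge_le_of_iIndepFun hindep (s := Finset.univ)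
    (fun i _ => hsub i) (ε := (q - t) * Fintype.card ι)
    (mul_nonneg (sub_nonneg.2 htq) (Nat.cast_nonneg _))
  calc (Measure.pi fun _ : ι => ν).real {u | ({i | u i ∈ G}.ncard : ℝ) < t * Fintype.card ι}
      ≤ (Measure.pi fun _ : ι => ν).real {u | (q - t) * Fintype.card ι ≤ ∑ i, dev i u} := by
        refine measureReal_mono fun u hu => ?_
        simp only [Set.mem_ofPred_eq, hsum] at hu ⊢
        nlinarith
    _ ≤ _ := hdev
    _ = _ := by
        simp only [sub_zero, nnnorm_one, Finset.sum_const, Finset.card_univ, nsmul_eq_mul,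
          NNReal.coe_mul, NNReal.coe_natCast, NNReal.coe_pow, NNReal.coe_div, NNReal.coe_one,
          NNReal.coe_ofNat]
        field_simp

end Hoeffding

/-! ### The loss of the main loop -/

theorem lintegral_le_add_mul_measure {α : Type*} [MeasurableSpace α] (μ : Measure α)
    [IsProbabilityMeasure μ] {f : α → ENNReal} {s : Set α} {a b : ENNReal}
    (hs : ∀ x ∈ s, f x ≤ b) (hsc : ∀ x ∉ s, f x ≤ a) : ∫⁻ x, f x ∂μ ≤ a + b * μ s := by
  classical
  calc ∫⁻ x, f x ∂μ ≤ ∫⁻ x, a + s.indicator (fun _ => b) x ∂μ := by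
        refine lintegral_mono fun x => ?_
        by_cases hx : x ∈ s
        · rw [Set.indicator_of_mem hx]
          exact (hs x hx).trans le_add_self
        · exact (hsc x hx).trans le_self_add
    _ = a + ∫⁻ x, s.indicator (fun _ => b) x ∂μ := by
        rw [lintegral_add_left measurable_const, lintegral_const, measure_univ, mul_one]
    _ ≤ a + b * μ s := by gcongr; exact lintegral_indicator_const_le s b

theorem sum_pi_div_two_pow_le (m n : ℕ) :
    ∑ i : Fin n, Real.pi / ((2 ^ (m + 1 + (i : ℕ)) : ℕ) : ℝ) ≤ Real.pi / 2 ^ m := by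
  calc ∑ i : Fin n, Real.pi / ((2 ^ (m + 1 + (i : ℕ)) : ℕ) : ℝ)
      = Real.pi / 2 ^ (m + 1) * ∑ i ∈ Finset.range n, (1 / 2 : ℝ) ^ i := by
        rw [Finset.mul_sum, Fin.sum_univ_eq_sum_range fun i =>
          Real.pi / ((2 ^ (m + 1 + i) : ℕ) : ℝ)]
        refine Finset.sum_congr rfl fun i _ => ?_
        push_cast
        rw [pow_add, one_div, inv_pow]
        field_simp
    _ ≤ Real.pi / 2 ^ (m + 1) * 2 := by
        gcongr
        exact sum_geometric_two_le n
    _ = Real.pi / 2 ^ m := by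
        rw [pow_succ]
        field_simp

section Loss

variable {d n : ℕ} [NeZero d] {A : Estimator d} {root : ℕ → UU d → UU d} {r : ℝ} {Z V : UU d}
  {F : UU d → ENNReal} {b : ENNReal}

theorem lintegral_bootLaw_succ (hA : A.IsMeasurable) (hroot : ∀ p, Measurable (root p)) (r : ℝ)
    (Z : UU d) (hF : Measurable F) (p N : Fin (n + 1) → ℕ) (V : UU d) :
    ∫⁻ U, F U ∂(bootLaw A root r Z p N V) =
      ∫⁻ u, ∫⁻ U, F U ∂(bootLaw A root r Z (fun j => p j.succ) (fun j => N j.succ)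
        (root (p 0) (central r u) * V))
        ∂(Measure.pi fun _ : Fin (N 0) => A.law ((Z * V⁻¹) ^ p 0)) := by
  have hnext : Measurable fun u : Fin (N 0) → UU d =>
      bootLaw A root r Z (fun j => p j.succ) (fun j => N j.succ) (root (p 0) (central r u) * V) :=
    (measurable_bootLaw hA hroot r Z (fun j => p j.succ) fun j => N j.succ).comp
      ((measurable_root_central hroot r (p 0) (N 0)).mul_const V)
  rw [bootLaw_succ hA hroot, Measure.lintegral_bind hnext.aemeasurable hF.aemeasurable]

theorem lintegral_bootLaw_le_of_forall (hA : A.IsMeasurable) (hroot : IsRootRule root)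
    (hF : Measurable F) {p N : Fin n → ℕ} (hp : ∀ i, 1 ≤ p i)
    (hFb : ∀ U : UU d, pdist (Z : Matrix (Fin d) (Fin d) ℂ) U ≤
      pdist (Z : Matrix (Fin d) (Fin d) ℂ) V + ∑ i, Real.pi / p i → F U ≤ b) :
    ∫⁻ U, F U ∂(bootLaw A root r Z p N V) ≤ b := by
  induction n generalizing V with
  | zero =>
    rw [bootLaw_zero, lintegral_dirac' _ hF]
    exact hFb V (by simp)
  | succ n ih =>
    have := hA.isProbabilityMeasure_law ((Z * V⁻¹) ^ p 0)
    rw [lintegral_bootLaw_succ hA hroot.measurable r Z hF]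
    refine (lintegral_mono fun u => ih (fun j => hp j.succ) fun U hU => hFb U ?_).trans_eq
      (by rw [lintegral_const, measure_univ, mul_one])
    have hround := pdist_projRoot_mul_le Z.2 V.2
      (hroot.isProjRoot (p 0) (hp 0) (central r u))
    rw [Submonoid.coe_mul] at hU
    rw [Fin.sum_univ_succ]
    linarith

/- Each remaining round moves the estimate by at most `π / p`, whatever the base algorithm
outputs. -/
theorem lintegral_bootLaw_le_of_tracks (hA : A.IsMeasurable) (hroot : IsRootRule root)
    (hF : Measurable F) {m : ℕ} (hV : Tracks Z m V) (U : UU d) {N : Fin n → ℕ}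
    (hFb : ∀ W : UU d, pdist (Z : Matrix (Fin d) (Fin d) ℂ) W ≤ 3 * Real.pi / 2 ^ m → F W ≤ b) :
    ∫⁻ W, F W ∂(bootLaw A root r Z (fun i => 2 ^ (m + 1 + (i : ℕ))) N (root (2 ^ m) U * V)) ≤
      b := by
  refine lintegral_bootLaw_le_of_forall hA hroot hF (fun _ => Nat.one_le_two_pow) fun W hW =>
    hFb W (hW.trans ?_)
  have hround := pdist_projRoot_mul_le Z.2 V.2 (hroot.isProjRoot (2 ^ m) Nat.one_le_two_pow U)
  have htail := sum_pi_div_two_pow_le m n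
  rw [Submonoid.coe_mul]
  rw [Nat.cast_pow, Nat.cast_ofNat] at hround
  calc _ ≤ Real.pi / 2 ^ m + Real.pi / 2 ^ m + Real.pi / 2 ^ m := by
        linarith [hV.pdist_le]
    _ = 3 * Real.pi / 2 ^ m := by ring

/-- The guarantee on the base algorithm: for every oracle, an error of at most `ε₀` has
probability `> 0.51`. -/
def Estimator.IsAccurate (A : Estimator d) (ε₀ : ℝ) : Prop :=
  ∀ Z : UU d, ENNReal.ofReal 0.51 <
    A.law Z {U : UU d | pdist (Z : Matrix (Fin d) (Fin d) ℂ) (U : Matrix (Fin d) (Fin d) ℂ) ≤ ε₀}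

theorem Estimator.IsAccurate.measure_pi_ncard_lt_le (hA : A.IsMeasurable) {ε₀ : ℝ}
    (hacc : A.IsAccurate ε₀) (O : UU d) (k : ℕ) :
    (Measure.pi fun _ : Fin k => A.law O) {u | ({i | pdist (O : Matrix (Fin d) (Fin d) ℂ)
        (u i) ≤ ε₀}.ncard : ℝ) < 0.505 * k} ≤ ENNReal.ofReal (Real.exp (-(k / 20000))) := by
  have := hA.isProbabilityMeasure_law O
  have hq : 0.51 ≤ (A.law O).real {U | pdist (O : Matrix (Fin d) (Fin d) ℂ) U ≤ ε₀} := by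
    rw [← ENNReal.ofReal_le_ofReal_iff measureReal_nonneg, ofReal_measureReal]
    exact (hacc O).le
  have hHoeffding := measureReal_pi_ncard_lt_le (ι := Fin k) (A.law O)
    (measurableSet_pdist_le O ε₀) (t := 0.505) (by norm_num) hq
  rw [Fintype.card_fin] at hHoeffding
  rw [← ofReal_measureReal]
  refine ENNReal.ofReal_le_ofReal (hHoeffding.trans_eq ?_)
  congr 1
  ring

theorem lintegral_bootLaw_le (hA : A.IsMeasurable) {ε₀ : ℝ} (hacc : A.IsAccurate ε₀)
    (hε₀ : ε₀ ≤ 1 / 600) (hroot : IsRootRule root) (hF : Measurable F) {m : ℕ} {N : Fin n → ℕ}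
    (hN : ∀ i, 0 < N i) (hV : Tracks Z m V) (hb : ∀ U : UU d, Tracks Z (m + n) U → F U ≤ b)
    {B : Fin n → ENNReal} (hB : ∀ i : Fin n, ∀ U : UU d,
      pdist (Z : Matrix (Fin d) (Fin d) ℂ) U ≤ 3 * Real.pi / 2 ^ (m + (i : ℕ)) → F U ≤ B i) :
    ∫⁻ U, F U ∂(bootLaw A root (2 * ε₀) Z (fun i => 2 ^ (m + (i : ℕ))) N V) ≤
      b + ∑ i, B i * ENNReal.ofReal (Real.exp (-((N i : ℝ) / 20000))) := by
  induction n generalizing m V with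
  | zero =>
    rw [bootLaw_zero, lintegral_dirac' _ hF]
    exact (hb V hV).trans le_self_add
  | succ n ih =>
    set O : UU d := (Z * V⁻¹) ^ 2 ^ m
    have := hA.isProbabilityMeasure_law O
    have hexp (j : Fin n) : m + (j.succ : ℕ) = m + 1 + j := by rw [Fin.val_succ]; ring
    have hbad (u : Fin (N 0) → UU d) := lintegral_bootLaw_le_of_tracks (r := 2 * ε₀) hA hroot hF hV
      (central (2 * ε₀) u) (N := fun j : Fin n => N j.succ) (hB 0)
    have hgood (u : Fin (N 0) → UU d) (hu : 0.505 * (N 0 : ℝ) ≤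
        {j | pdist (O : Matrix (Fin d) (Fin d) ℂ) (u j) ≤ ε₀}.ncard) :=
      ih (m := m + 1) (N := fun j => N j.succ) (B := fun j => B j.succ) (fun j => hN j.succ)
        (hV.succ hroot ((pdist_central_le O (hN 0) hu).trans (by linarith)))
        (by simpa only [add_assoc, add_comm 1] using hb)
        (fun j => by simpa only [hexp] using hB j.succ)
    rw [lintegral_bootLaw_succ hA hroot.measurable _ Z hF, Fin.sum_univ_succ, add_comm (B 0 * _),
      ← add_assoc]
    simp only [Fin.val_zero, add_zero, hexp]
    refine (lintegral_le_add_mul_measure _ (fun u _ => hbad u)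
      fun u hu => hgood u (not_lt.1 hu)).trans ?_
    gcongr
    exact hacc.measure_pi_ncard_lt_le hA O (N 0)

end Loss

/-! ### The parameters of the bootstrap algorithm -/

section Parameters

variable {c ε η : ℝ} {j : ℕ}

theorem one_div_le_two_pow_rounds (hε : 0 < ε) : 1 / ε ≤ 2 ^ rounds ε := by
  have h : Real.logb 2 (1 / ε) ≤ (rounds ε : ℝ) := Nat.le_ceil _
  rwa [Real.logb_le_iff_le_rpow one_lt_two (one_div_pos.2 hε), Real.rpow_natCast] at h

theorem two_pow_rounds_le (hε : ε ∈ Set.Ioo 0 1) : 2 ^ rounds ε ≤ 2 * (1 / ε) := by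
  have hpos : 0 < 1 / ε := one_div_pos.2 hε.1
  have hlog : 0 ≤ Real.logb 2 (1 / ε) := Real.logb_nonneg one_lt_two (one_le_one_div hε.1 hε.2.le)
  have h : (rounds ε : ℝ) ≤ Real.logb 2 (1 / ε) + 1 := (Nat.ceil_lt_add_one hlog).le
  calc (2 : ℝ) ^ rounds ε = 2 ^ (rounds ε : ℝ) := (Real.rpow_natCast 2 _).symm
    _ ≤ 2 ^ (Real.logb 2 (1 / ε) + 1) := Real.rpow_le_rpow_of_exponent_le one_le_two h
    _ = 2 * (1 / ε) := by
        rw [Real.rpow_add two_pos, Real.rpow_logb two_pos (by norm_num) hpos, Real.rpow_one,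
          mul_comm]

theorem failure_eq (ε η : ℝ) (j : ℕ) : failure ε η j = η * 8 ^ j / 8 ^ (rounds ε + 1) := by
  rw [failure, sub_sub, zpow_sub₀ (by norm_num), zpow_natCast, mul_div_assoc]
  norm_cast

theorem failure_pos (hη : 0 < η) : 0 < failure ε η j :=
  mul_pos hη (by positivity)

theorem failure_lt_one (hη : η < 1) (hj : j ≤ rounds ε) : failure ε η j < 1 := by
  rw [failure_eq, div_lt_one (by positivity)]
  calc η * 8 ^ j < 1 * 8 ^ j := by gcongr
    _ = 8 ^ j := one_mul _
    _ ≤ 8 ^ (rounds ε + 1) := pow_le_pow_right₀ (by norm_num) (by omega)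

theorem log_one_div_failure_pos (hη : η ∈ Set.Ioo 0 1) (hj : j ≤ rounds ε) :
    0 < Real.log (1 / failure ε η j) :=
  Real.log_pos (one_lt_one_div (failure_pos hη.1) (failure_lt_one hη.2 hj))

theorem repetitions_pos (hc : 0 < c) (hη : η ∈ Set.Ioo 0 1) (hj : j ≤ rounds ε) :
    0 < repetitions c ε η j :=
  Nat.ceil_pos.2 (mul_pos hc (log_one_div_failure_pos hη hj))

theorem exp_neg_repetitions_le (hc : 20000 ≤ c) (hη : η ∈ Set.Ioo 0 1) (hj : j ≤ rounds ε) :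
    Real.exp (-(repetitions c ε η j / 20000)) ≤ failure ε η j := by
  rw [← Real.le_log_iff_exp_le (failure_pos hη.1), neg_le, ← Real.log_inv, ← one_div,
    le_div_iff₀' (by norm_num)]
  calc 20000 * Real.log (1 / failure ε η j) ≤ c * Real.log (1 / failure ε η j) := by
        have := log_one_div_failure_pos hη hj
        gcongr
    _ ≤ repetitions c ε η j := Nat.le_ceil _

theorem sum_failure_le (ε : ℝ) (hη : 0 ≤ η) :
    ∑ j ∈ Finset.range (rounds ε + 1), failure ε η j ≤ η := by
  simp only [failure_eq]
  rw [← Finset.sum_div, ← Finset.mul_sum, geom_sum_eq (by norm_num), div_le_iff₀ (by positivity)]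
  have : (0 : ℝ) < 8 ^ (rounds ε + 1) := by positivity
  gcongr
  linarith

theorem sum_sq_mul_failure_le (hε : 0 < ε) (hη : 0 ≤ η) :
    ∑ j ∈ Finset.range (rounds ε + 1), (3 * Real.pi / 2 ^ j) ^ 2 * failure ε η j ≤
      32 * η * ε ^ 2 := by
  have hterm (j : ℕ) : (3 * Real.pi / 2 ^ j) ^ 2 * failure ε η j =
      9 * Real.pi ^ 2 * η / 8 ^ (rounds ε + 1) * 2 ^ j := by
    have h8 : (8 : ℝ) ^ j = (2 ^ j) ^ 3 := by rw [← pow_mul, mul_comm, pow_mul]; norm_num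
    rw [failure_eq, h8]
    field_simp
    ring
  have hgeom : ∑ j ∈ Finset.range (rounds ε + 1), (2 : ℝ) ^ j ≤ 2 * 2 ^ rounds ε := by
    rw [geom_sum_eq (by norm_num), pow_succ]
    linarith
  have hpi : 9 / 4 * Real.pi ^ 2 ≤ 32 := by nlinarith [Real.pi_lt_d2, Real.pi_pos]
  have hx : 1 / 2 ^ rounds ε ≤ ε := by
    rw [one_div_le (by positivity) hε]
    exact one_div_le_two_pow_rounds hε
  calc ∑ j ∈ Finset.range (rounds ε + 1), (3 * Real.pi / 2 ^ j) ^ 2 * failure ε η j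
      = 9 * Real.pi ^ 2 * η / 8 ^ (rounds ε + 1) *
          ∑ j ∈ Finset.range (rounds ε + 1), 2 ^ j := by simp only [hterm, Finset.mul_sum]
    _ ≤ 9 * Real.pi ^ 2 * η / 8 ^ (rounds ε + 1) * (2 * 2 ^ rounds ε) := by gcongr
    _ = 9 / 4 * Real.pi ^ 2 * η * (1 / 2 ^ rounds ε) ^ 2 := by
        have h8 : (8 : ℝ) ^ (rounds ε + 1) = 8 * (2 ^ rounds ε) ^ 3 := by
          rw [pow_succ, ← pow_mul, mul_comm (rounds ε), pow_mul]; norm_num; ring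
        rw [h8]
        field_simp
        ring
    _ ≤ 32 * η * ε ^ 2 := by gcongr

theorem log_one_div_failure (hη : 0 < η) (ε : ℝ) (j : ℕ) :
    Real.log (1 / failure ε η j) = Real.log (1 / η) + (rounds ε + 1 - j) * Real.log 8 := by
  rw [failure_eq, one_div, one_div, Real.log_inv, Real.log_inv,
    Real.log_div (mul_ne_zero hη.ne' (by positivity)) (by positivity),
    Real.log_mul hη.ne' (by positivity), Real.log_pow, Real.log_pow]
  push_cast
  ring

theorem repetitions_le (hc : 0 ≤ c) (hη : η ∈ Set.Ioo 0 1) (hj : j ≤ rounds ε) :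
    (repetitions c ε η j : ℝ) ≤
      max 1 (Real.log (1 / η)) * (c + 1 + 3 * c * (rounds ε + 1 - j)) := by
  set L := max 1 (Real.log (1 / η))
  have hL : 1 ≤ L := le_max_left _ _
  have hlog8 : Real.log 8 ≤ 3 := by
    rw [show (8 : ℝ) = 2 ^ 3 by norm_num, Real.log_pow, Nat.cast_ofNat]
    linarith [Real.log_two_lt_d9]
  have hj' : (0 : ℝ) ≤ rounds ε + 1 - j := by
    have : (j : ℝ) ≤ rounds ε := Nat.cast_le.2 hj
    linarith
  calc (repetitions c ε η j : ℝ) ≤ c * Real.log (1 / failure ε η j) + 1 :=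
        (Nat.ceil_lt_add_one (mul_nonneg hc (log_one_div_failure_pos hη hj).le)).le
    _ = c * (Real.log (1 / η) + (rounds ε + 1 - j) * Real.log 8) + 1 := by
        rw [log_one_div_failure hη.1]
    _ ≤ c * (L + (rounds ε + 1 - j) * 3) + 1 := by
        gcongr
        exact le_max_right _ _
    _ ≤ c * (L + L * ((rounds ε + 1 - j) * 3)) + L := by
        gcongr c * (L + ?_) + ?_
        exact le_mul_of_one_le_left (mul_nonneg hj' zero_le_three) hL
    _ = L * (c + 1 + 3 * c * (rounds ε + 1 - j)) := by ring

theorem sum_two_pow_mul_sub (T : ℕ) :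
    ∑ j ∈ Finset.range (T + 1), (2 : ℝ) ^ j * (T + 1 - j) = 2 ^ (T + 2) - T - 3 := by
  induction T with
  | zero => norm_num
  | succ T ih =>
    have h (j : ℕ) : (2 : ℝ) ^ j * ((T + 1 : ℕ) + 1 - j) = 2 ^ j * (T + 1 - j) + 2 ^ j := by
      push_cast
      ring
    rw [Finset.sum_range_succ, Finset.sum_congr rfl fun j _ => h j, Finset.sum_add_distrib, ih,
      geom_sum_eq (by norm_num)]
    push_cast
    ring

theorem sum_repetitions_mul_two_pow_le (hc : 0 ≤ c) (hε : ε ∈ Set.Ioo 0 1)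
    (hη : η ∈ Set.Ioo 0 1) :
    ∑ j ∈ Finset.range (rounds ε + 1), (repetitions c ε η j : ℝ) * 2 ^ j ≤
      (28 * c + 4) * (1 / ε * max 1 (Real.log (1 / η))) := by
  set L := max 1 (Real.log (1 / η))
  have : 0 ≤ L := zero_le_one.trans (le_max_left _ _)
  set T := rounds ε
  calc ∑ j ∈ Finset.range (T + 1), (repetitions c ε η j : ℝ) * 2 ^ j
      ≤ ∑ j ∈ Finset.range (T + 1),
          (L * (c + 1) * 2 ^ j + 3 * c * L * (2 ^ j * (T + 1 - j))) := by
        refine Finset.sum_le_sum fun j hj => ?_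
        have h := repetitions_le hc hη (Nat.lt_succ_iff.1 (Finset.mem_range.1 hj))
        refine (mul_le_mul_of_nonneg_right h (by positivity)).trans_eq ?_
        ring
    _ = L * (c + 1) * (2 ^ (T + 1) - 1) + 3 * c * L * (2 ^ (T + 2) - T - 3) := by
        rw [Finset.sum_add_distrib, ← Finset.mul_sum, ← Finset.mul_sum, sum_two_pow_mul_sub,
          geom_sum_eq (by norm_num)]
        norm_num
    _ ≤ L * (c + 1) * 2 ^ (T + 1) + 3 * c * L * 2 ^ (T + 2) := by
        have : (0 : ℝ) ≤ T := Nat.cast_nonneg T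
        gcongr <;> linarith
    _ = (14 * c + 2) * L * 2 ^ T := by ring
    _ ≤ (14 * c + 2) * L * (2 * (1 / ε)) := by
        gcongr
        exact two_pow_rounds_le hε
    _ = (28 * c + 4) * (1 / ε * L) := by ring

end Parameters

/-! ### The guarantees of the bootstrap algorithm -/

section Bootstrap

variable {d : ℕ} [NeZero d] {A : Estimator d} {c ε₀ ε η : ℝ}

theorem queries_bootLoop_le {Q : ℕ} (hQ : ∀ s, (A.prog s).queries ≤ Q) (root : ℕ → UU d → UU d)
    (r : ℝ) {n : ℕ} (p N : Fin n → ℕ) (s : (j : Fin n) → Fin (N j) → A.Seed) (V : UU d) :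
    (bootLoop A root r p N s V).queries ≤ ∑ j, N j * (p j * Q) := by
  induction n generalizing V with
  | zero => exact Nat.zero_le _
  | succ n ih =>
    rw [bootLoop, Fin.sum_univ_succ]
    exact Prog.queries_runAll_le
      (fun i => (Prog.queries_withOracle_le _ _ _).trans (Nat.mul_le_mul_left _ (hQ _)))
      fun u => ih _ _ _ _

theorem usesAtMost_bootstrap (hc : 0 ≤ c) (root : ℕ → UU d → UU d) (ε₀ : ℝ)
    (hε : ε ∈ Set.Ioo 0 1) (hη : η ∈ Set.Ioo 0 1) {Q : ℕ} (hQ : A.UsesAtMost Q) :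
    (bootstrap c A root ε₀ ε η).UsesAtMost
      ((28 * c + 4) * (Q / ε * max 1 (Real.log (1 / η)))) := fun s => by
  have h : ((bootstrap c A root ε₀ ε η).prog s).queries ≤
      ∑ j : Fin (rounds ε + 1), repetitions c ε η j * (2 ^ (j : ℕ) * Q) :=
    queries_bootLoop_le (fun s => Nat.cast_le.1 (hQ s)) root (2 * ε₀)
      (fun j : Fin (rounds ε + 1) => 2 ^ (j : ℕ)) _ s 1
  rw [Fin.sum_univ_eq_sum_range fun j => repetitions c ε η j * (2 ^ j * Q)] at h
  calc (((bootstrap c A root ε₀ ε η).prog s).queries : ℝ)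
      ≤ ((∑ j ∈ Finset.range (rounds ε + 1), repetitions c ε η j * (2 ^ j * Q) : ℕ) : ℝ) :=
        Nat.cast_le.2 h
    _ = (∑ j ∈ Finset.range (rounds ε + 1), (repetitions c ε η j : ℝ) * 2 ^ j) * Q := by
        push_cast
        simp only [Finset.sum_mul, mul_assoc]
    _ ≤ (28 * c + 4) * (1 / ε * max 1 (Real.log (1 / η))) * Q := by
        gcongr
        exact sum_repetitions_mul_two_pow_le hc hε hη
    _ = (28 * c + 4) * (Q / ε * max 1 (Real.log (1 / η))) := by ring

variable {root : ℕ → UU d → UU d}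

theorem lintegral_law_bootstrap_le (hc : 20000 ≤ c) (hA : A.IsMeasurable)
    (hroot : IsRootRule root) (hε₀ : ε₀ ≤ 1 / 600) (hacc : A.IsAccurate ε₀) (hε : 0 < ε)
    (hη : η ∈ Set.Ioo 0 1) (Z : UU d) {f : UU d → ℝ} (hf : Measurable f) {b : ℝ} (hb0 : 0 ≤ b)
    (hb : ∀ U : UU d, pdist (Z : Matrix (Fin d) (Fin d) ℂ) U ≤ ε → f U ≤ b) {B : ℕ → ℝ}
    (hB0 : ∀ j, 0 ≤ B j) (hB : ∀ (j : ℕ) (U : UU d),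
      pdist (Z : Matrix (Fin d) (Fin d) ℂ) U ≤ 3 * Real.pi / 2 ^ j → f U ≤ B j) :
    ∫⁻ U, ENNReal.ofReal (f U) ∂((bootstrap c A root ε₀ ε η).law Z) ≤
      ENNReal.ofReal (b + ∑ j ∈ Finset.range (rounds ε + 1), B j * failure ε η j) := by
  have hlaw : (bootstrap c A root ε₀ ε η).law Z =
      bootLaw A root (2 * ε₀) Z (fun j : Fin (rounds ε + 1) => 2 ^ (0 + (j : ℕ)))
        (fun j => repetitions c ε η j) 1 := by
    simp only [zero_add]
    rfl
  have hend (U : UU d) (hU : Tracks Z (0 + (rounds ε + 1)) U) :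
      pdist (Z : Matrix (Fin d) (Fin d) ℂ) U ≤ ε := by
    have hrounds := one_div_le_two_pow_rounds hε
    rw [div_le_iff₀ hε] at hrounds
    refine (hU (by omega)).le.trans ?_
    rw [zero_add, div_le_iff₀ (by positivity), pow_succ]
    linarith
  have hj (j : Fin (rounds ε + 1)) : (j : ℕ) ≤ rounds ε := Nat.lt_succ_iff.1 j.2
  have hterm (j : ℕ) : 0 ≤ B j * failure ε η j := mul_nonneg (hB0 j) (failure_pos hη.1).le
  rw [hlaw, ENNReal.ofReal_add hb0 (Finset.sum_nonneg fun j _ => hterm j),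
    ENNReal.ofReal_sum_of_nonneg fun j _ => hterm j,
    ← Fin.sum_univ_eq_sum_range fun j => ENNReal.ofReal (B j * failure ε η j)]
  refine (lintegral_bootLaw_le hA hacc hε₀ hroot hf.ennreal_ofReal
    (fun j => repetitions_pos (by linarith) hη (hj j)) (fun h => absurd rfl h)
    (fun U hU => ENNReal.ofReal_le_ofReal (hb U (hend U hU)))
    (B := fun j => ENNReal.ofReal (B j))
    fun j U hU => ENNReal.ofReal_le_ofReal (hB j U (by simpa only [zero_add] using hU))).trans ?_
  gcongr with j
  rw [ENNReal.ofReal_mul (hB0 j)]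
  gcongr
  exact exp_neg_repetitions_le hc hη (hj j)

theorem le_law_bootstrap_pdist_le (hc : 20000 ≤ c) (hA : A.IsMeasurable)
    (hroot : IsRootRule root) (hε₀ : ε₀ ≤ 1 / 600) (hacc : A.IsAccurate ε₀) (hε : 0 < ε)
    (hη : η ∈ Set.Ioo 0 1) (Z : UU d) :
    ENNReal.ofReal (1 - η) ≤ (bootstrap c A root ε₀ ε η).law Z
      {U : UU d | pdist (Z : Matrix (Fin d) (Fin d) ℂ) U ≤ ε} := by
  set G := {U : UU d | pdist (Z : Matrix (Fin d) (Fin d) ℂ) U ≤ ε}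
  have hG : MeasurableSet G := measurableSet_pdist_le Z ε
  have hboot := isMeasurable_bootstrap c hA hroot.measurable ε₀ ε η
  have := hboot.isProbabilityMeasure_law Z
  have hbad : (bootstrap c A root ε₀ ε η).law Z Gᶜ ≤ ENNReal.ofReal η := by
    calc (bootstrap c A root ε₀ ε η).law Z Gᶜ
        = ∫⁻ U, ENNReal.ofReal (Gᶜ.indicator 1 U) ∂((bootstrap c A root ε₀ ε η).law Z) := by
          rw [← lintegral_indicator_one hG.compl]
          congr with U
          by_cases hU : U ∈ Gᶜ <;> simp [hU]
      _ ≤ ENNReal.ofReal (0 + ∑ j ∈ Finset.range (rounds ε + 1), 1 * failure ε η j) :=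
          lintegral_law_bootstrap_le hc hA hroot hε₀ hacc hε hη Z
            (measurable_one.indicator hG.compl) le_rfl
            (fun U hU => (Set.indicator_of_notMem (not_not.2 hU) _).le)
            (B := fun _ => 1) (fun _ => zero_le_one)
            fun _ U _ => Set.indicator_le_self' (fun _ _ => zero_le_one) U
      _ ≤ ENNReal.ofReal η := by
          refine ENNReal.ofReal_le_ofReal ?_
          simpa only [zero_add, one_mul] using sum_failure_le ε hη.1.le
  rw [prob_compl_eq_one_sub hG] at hbad
  rw [ENNReal.ofReal_sub _ hη.1.le, ENNReal.ofReal_one]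
  exact tsub_le_iff_tsub_le.1 hbad

theorem lintegral_sq_pdist_law_bootstrap_le (hc : 20000 ≤ c) (hA : A.IsMeasurable)
    (hroot : IsRootRule root) (hε₀ : ε₀ ≤ 1 / 600) (hacc : A.IsAccurate ε₀) (hε : 0 < ε)
    (hη : η ∈ Set.Ioo 0 1) (Z : UU d) :
    ∫⁻ U, ENNReal.ofReal (pdist (Z : Matrix (Fin d) (Fin d) ℂ) U ^ 2)
        ∂((bootstrap c A root ε₀ ε η).law Z) ≤ ENNReal.ofReal ((1 + 32 * η) * ε ^ 2) := by
  refine (lintegral_law_bootstrap_le hc hA hroot hε₀ hacc hε hη Z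
    ((measurable_pdist_right Z).pow_const 2) (sq_nonneg ε)
    (fun U hU => pow_le_pow_left₀ (pdist_nonneg _ _) hU 2)
    (B := fun j => (3 * Real.pi / 2 ^ j) ^ 2) (fun _ => sq_nonneg _)
    fun j U hU => pow_le_pow_left₀ (pdist_nonneg _ _) hU 2).trans (ENNReal.ofReal_le_ofReal ?_)
  linarith [sum_sq_mul_failure_le hε hη.1.le]

end Bootstrap

end Tomography

theorem theorem4 :
    ∃ c C : ℝ, 0 < c ∧ 0 < C ∧
      ∀ (d : ℕ) [NeZero d] (A : Tomography.Estimator d) (root : ℕ → Tomography.UU d → Tomography.UU d)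
        (ε₀ ε η : ℝ),
        A.IsMeasurable →
        Tomography.IsRootRule root →
        ε₀ ≤ 1 / 600 →
        (∀ Z : Tomography.UU d,
          ENNReal.ofReal 0.51 <
            A.law Z {U | Tomography.pdist (Z : Matrix (Fin d) (Fin d) ℂ) U ≤ ε₀}) →
        ε ∈ Set.Ioo (0 : ℝ) 1 → η ∈ Set.Ioo (0 : ℝ) 1 →
        (Tomography.bootstrap c A root ε₀ ε η).IsMeasurable ∧
        (∀ Z : Tomography.UU d,
          ENNReal.ofReal (1 - η) ≤ (Tomography.bootstrap c A root ε₀ ε η).law Z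
            {U | Tomography.pdist (Z : Matrix (Fin d) (Fin d) ℂ) U ≤ ε}) ∧
        (∀ Z : Tomography.UU d,
          ∫⁻ U, ENNReal.ofReal (Tomography.pdist (Z : Matrix (Fin d) (Fin d) ℂ) U ^ 2)
              ∂((Tomography.bootstrap c A root ε₀ ε η).law Z) ≤
            ENNReal.ofReal ((1 + 32 * η) * ε ^ 2)) ∧
        (∀ Q : ℕ, A.UsesAtMost Q →
          (Tomography.bootstrap c A root ε₀ ε η).UsesAtMost
            (C * (Q / ε * max 1 (Real.log (1 / η))))) := by
  refine ⟨20000, 28 * 20000 + 4, by norm_num, by norm_num, ?_⟩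
  intro d _ A root ε₀ ε η hA hroot hε₀ hacc hε hη
  refine ⟨?_, fun Z => ?_, fun Z => ?_, fun Q hQ => ?_⟩
  · exact Tomography.isMeasurable_bootstrap 20000 hA hroot.measurable ε₀ ε η
  · exact Tomography.le_law_bootstrap_pdist_le le_rfl hA hroot hε₀ hacc hε.1 hη Z
  · exact Tomography.lintegral_sq_pdist_law_bootstrap_le le_rfl hA hroot hε₀ hacc hε.1 hη Z
  · exact Tomography.usesAtMost_bootstrap (by norm_num) root ε₀ hε hη hQ
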